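/- **Relative Hochster–Takayama formula.** Let $k$ be a field, $S=k[x_1,\dots,x_n]$ with its standard $\mathbb Z^n$-grading, $\mathfrak m=(x_1,\dots,x_n)$, and let $J\subsetneq I$ be monomial ideals of $S$. For $a\in\mathbb Z^n$ put $G_a=\{i : a_i<0\}$. For a monomial ideal $K$ let $\Delta_a(K)$ be the degree complex: the simplicial complex of all $F\subseteq[n]$ such that $F\cap G_a=\varnothing$ and, for every minimal monomial generator $x^b$ of $K$, there is an $i\notin F\cup G_a$ with $b_i>a_i$ (this complex may have no face at all, or only the face $\varnothing$). Then $\Delta_a(I)\subseteq\Delta_a(J)$, and for every $i\in\mathbb Z$ and every $a\in\mathbb Z^n$ there is an isomorphism of $k$-vector spaces $$H^i_{\mathfrak m}(I/J)_a\;\cong\;\widetilde H^{\,i-|G_a|-1}\big((\Delta_a(J),\Delta_a(I));k\big).$$ Here $H^i_{\mathfrak m}$ is local cohomology with its $\mathbb Z^n$-grading (zero for $i<0$), and, for simplicial complexes $\Gamma\subseteq\Delta$ on $[n]$, $\widetilde H^{t}((\Delta,\Gamma);k)$ is the $t$-th cohomology of $\operatorname{Hom}_{\mathbb Z}(\mathcal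 C(\Delta)_\bullet/\mathcal C(\Gamma)_\bullet,k)$, where $\mathcal C(\cdot)_\bullet$ is the augmented oriented chain complex (with $\varnothing$, if it is a face, in degree $-1$). Moreover, $H^i_{\mathfrak m}(I/J)_a=0$ for every $i$ whenever $\prod_{j\in G_a}x_j\in\sqrt J$, i.e. whenever $G_a$ is not a face of the Stanley–Reisner complex $\Delta(\sqrt J)=\{F\subseteq[n] : \prod_{j\in F}x_j\notin\sqrt J\}$. -/

import Mathlib

open CategoryTheory Opposite

universe u

noncomputable section

namespace RelativeTakayama

/-! ### Simplicial complexes on `[n]` and reduced relative cohomology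

A simplicial complex on `[n]` is a family of subsets of `[n]` that is closed under taking subsets,
i.e. a lower set in `Finset (Fin n)`. Vertices need not be faces, and both the complex without
faces (`⊥`) and the complex whose only face is `∅` are allowed. -/

/-- A simplicial complex on the vertex set `[n]`. -/
abbrev Complex (n : ℕ) : Type := LowerSet (Finset (Fin n))

/-- A relative simplicial complex: a simplicial complex `Δ` with a subcomplex `Γ`. -/
structure RelComplex (n : ℕ) where
  Δ : Complex n
  Γ : Complex n
  le : Γ ≤ Δ

/-- The faces of dimension `t`, i.e. with `t + 1` elements. In dimension `-1` this is the
face `∅`, if it belongs to `Δ`. -/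
abbrev Face {n : ℕ} (Δ : Complex n) (t : ℤ) : Type :=
  {F : Finset (Fin n) // F ∈ Δ ∧ (F.card : ℤ) = t + 1}

/-- The group `C_t` of the augmented oriented chain complex: the free abelian group on the faces
of dimension `t`. -/
abbrev Chain {n : ℕ} (Δ : Complex n) (t : ℤ) : Type := Face Δ t →₀ ℤ

/-- The facet `F \ {v}` of a face `F`. -/
def Face.erase {n : ℕ} {Δ : Complex n} {s t : ℤ} (h : s = t + 1) (F : Face Δ s)
    (v : {v // v ∈ F.1}) : Face Δ t :=
  ⟨F.1.erase v.1, Δ.lower (Finset.erase_subset _ _) F.2.1, by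
    have h1 := Finset.card_erase_add_one v.2
    have h2 := F.2.2
    omega⟩

/-- The position of `v` in `F`, when the elements of `F` are listed increasingly from `0` on. -/
def position {n : ℕ} (F : Finset (Fin n)) (v : Fin n) : ℕ := (F.filter (· < v)).card

/-- The boundary map `C_{t+1} → C_t`, `F = {i_0 < ⋯ < i_{t+1}} ↦ ∑ⱼ (-1)ʲ (F \ {i_j})`. -/
def boundary {n : ℕ} (Δ : Complex n) {s t : ℤ} (h : s = t + 1) : Chain Δ s →ₗ[ℤ] Chain Δ t :=
  Finsupp.lsum ℤ fun F => LinearMap.toSpanSingleton ℤ (Chain Δ t)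
    (∑ v : {v // v ∈ F.1}, Finsupp.single (F.erase h v) ((-1 : ℤ) ^ position F.1 v.1))

/-- The subgroup `C_t(Γ)` of `C_t(Δ)`, spanned by the faces in the subcomplex `Γ`. -/
def subChain {n : ℕ} (Φ : RelComplex n) (t : ℤ) : Submodule ℤ (Chain Φ.Δ t) :=
  Submodule.span ℤ {c | ∃ F : Face Φ.Δ t, F.1 ∈ Φ.Γ ∧ c = Finsupp.single F 1}

/-- The boundary of a chain of the subcomplex is a chain of the subcomplex. -/
theorem subChain_le_comap {n : ℕ} (Φ : RelComplex n) {s t : ℤ} (h : s = t + 1) :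
    subChain Φ s ≤ (subChain Φ t).comap (boundary Φ.Δ h) := by
  refine Submodule.span_le.2 ?_
  rintro _ ⟨F, hF, rfl⟩
  simp only [SetLike.mem_coe, Submodule.mem_comap, boundary, Finsupp.lsum_single,
    LinearMap.toSpanSingleton_apply, one_smul]
  refine Submodule.sum_mem _ fun v _ => ?_
  have h1 : Finsupp.single (F.erase h v) ((-1 : ℤ) ^ position F.1 v.1)
      = ((-1 : ℤ) ^ position F.1 v.1) • Finsupp.single (F.erase h v) (1 : ℤ) := by
    rw [Finsupp.smul_single, smul_eq_mul, mul_one]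
  rw [h1]
  exact Submodule.smul_mem _ _ (Submodule.subset_span
    ⟨_, Φ.Γ.lower (Finset.erase_subset _ _) hF, rfl⟩)

/-- The group `C_t(Δ) / C_t(Γ)` of relative chains. -/
abbrev RelChain {n : ℕ} (Φ : RelComplex n) (t : ℤ) : Type := Chain Φ.Δ t ⧸ subChain Φ t

/-- The boundary map of the quotient complex `C(Δ) / C(Γ)`. -/
def relBoundary {n : ℕ} (Φ : RelComplex n) {s t : ℤ} (h : s = t + 1) :
    RelChain Φ s →ₗ[ℤ] RelChain Φ t :=
  Submodule.mapQ _ _ (boundary Φ.Δ h) (subChain_le_comap Φ h)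

/-- The coboundary map `Hom(C_t(Δ)/C_t(Γ), k) → Hom(C_{t+1}(Δ)/C_{t+1}(Γ), k)`. -/
def coboundary (k : Type u) [Field k] {n : ℕ} (Φ : RelComplex n) {s t : ℤ} (h : s = t + 1) :
    (RelChain Φ t →ₗ[ℤ] k) →ₗ[k] (RelChain Φ s →ₗ[ℤ] k) :=
  LinearMap.lcomp k k (relBoundary Φ h)

/-- The reduced relative cohomology `H̃^t((Δ, Γ); k)`: cocycles modulo coboundaries of the complex
`Hom(C(Δ)/C(Γ), k)`. -/
abbrev RelCohomology (k : Type u) [Field k] {n : ℕ} (Φ : RelComplex n) (t : ℤ) : Type u :=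
  LinearMap.ker (coboundary k Φ (s := t + 1) (t := t) rfl) ⧸
    (LinearMap.range (coboundary k Φ (s := t) (t := t - 1) (by omega))).submoduleOf
      (LinearMap.ker (coboundary k Φ (s := t + 1) (t := t) rfl))

/-! ### Monomial ideals and degree complexes -/

section Monomial

variable {k : Type u} [Field k] {n : ℕ}

/-- `I` is generated by monomials. -/
def IsMonomialIdeal (I : Ideal (MvPolynomial (Fin n) k)) : Prop :=
  ∃ A : Set (Fin n →₀ ℕ), I = Ideal.span ((fun b => MvPolynomial.monomial b (1 : k)) '' A)

/-- `x^b` is a minimal monomial generator of the monomial ideal `I`: it belongs to `I` and no proper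
divisor of it does. -/
def IsMinGen (I : Ideal (MvPolynomial (Fin n) k)) (b : Fin n →₀ ℕ) : Prop :=
  Minimal (fun c : Fin n →₀ ℕ => MvPolynomial.monomial c (1 : k) ∈ I) b

/-- `G_a`, the set of the indices with `a_i < 0`. -/
def negSupport (a : Fin n → ℤ) : Finset (Fin n) := Finset.univ.filter fun i => a i < 0

/-- The degree complex `Δ_a(I)`. -/
def degreeComplex (I : Ideal (MvPolynomial (Fin n) k)) (a : Fin n → ℤ) : Complex n where
  carrier := {F | F ∩ negSupport a = ∅ ∧
    ∀ b, IsMinGen I b → ∃ i, i ∉ F ∪ negSupport a ∧ a i < (b i : ℤ)}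
  lower' := by
    rintro F F' hF ⟨h1, h2⟩
    refine ⟨?_, fun b hb => ?_⟩
    · exact Finset.subset_empty.1 (h1 ▸ Finset.inter_subset_inter_right hF)
    · obtain ⟨i, hi, hab⟩ := h2 b hb
      exact ⟨i, fun h => hi (Finset.union_subset_union_left hF h), hab⟩

/-- For monomial ideals `J ⊆ I`, the complex `Δ_a(I)` is a subcomplex of `Δ_a(J)`. -/
theorem degreeComplex_anti {I J : Ideal (MvPolynomial (Fin n) k)} (h : J ≤ I) (a : Fin n → ℤ) :
    degreeComplex I a ≤ degreeComplex J a := by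
  rintro F ⟨h1, h2⟩
  refine ⟨h1, fun b hb => ?_⟩
  obtain ⟨c, hcb, hc⟩ := exists_minimal_le_of_wellFoundedLT
    (fun c : Fin n →₀ ℕ => MvPolynomial.monomial c (1 : k) ∈ I) b (h hb.1)
  obtain ⟨i, hi, hai⟩ := h2 c hc
  exact ⟨i, hi, hai.trans_le (by exact_mod_cast hcb i)⟩

/-- The pair of degree complexes `(Δ_a(J), Δ_a(I))`, for ideals `J ⊆ I`. -/
def relDegreeComplex {I J : Ideal (MvPolynomial (Fin n) k)} (h : J ≤ I) (a : Fin n → ℤ) :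
    RelComplex n where
  Δ := degreeComplex J a
  Γ := degreeComplex I a
  le := degreeComplex_anti h a

/-- The Stanley–Reisner complex `Δ(I) = {F | x_F ∉ I}`. -/
def stanleyReisner (I : Ideal (MvPolynomial (Fin n) k)) : Complex n where
  carrier := {F | ∏ i ∈ F, (MvPolynomial.X i : MvPolynomial (Fin n) k) ∉ I}
  lower' := fun _ _ hF h h' => h (I.mem_of_dvd (Finset.prod_dvd_prod_of_subset _ _ _ hF) h')

end Monomial

/-! ### Multigraded modules over the polynomial ring -/

section Graded

variable (k : Type u) [Field k] (n : ℕ)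

/-- The fine `ℤ^n`-grading of `k[x_1, …, x_n]`, in which `x_j` has degree `e_j`: its part of
degree `a` is `k x^a` if `a ∈ ℕ^n`, and `0` otherwise. -/
abbrev polyPart (a : Fin n → ℤ) : Submodule k (MvPolynomial (Fin n) k) :=
  MvPolynomial.weightedHomogeneousSubmodule k (fun j : Fin n => (Pi.single j 1 : Fin n → ℤ)) a

variable {k n}

/-- The subgroups `𝓜 a` (for `a ∈ ℤ^n`) make `M` a `ℤ^n`-graded `k[x_1, …, x_n]`-module: `M` is
their direct sum, and `S_a 𝓜_b ⊆ 𝓜_{a+b}`. -/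
structure IsMultigrading {M : Type u} [AddCommGroup M] [Module (MvPolynomial (Fin n) k) M]
    (𝓜 : (Fin n → ℤ) → AddSubgroup M) : Prop where
  isInternal : DirectSum.IsInternal 𝓜
  gradedSMul : SetLike.GradedSMul (polyPart k n) 𝓜

/-- The induced grading of the quotient ring `S/K`, for a monomial ideal `K`. -/
def quotPart (K : Ideal (MvPolynomial (Fin n) k)) (a : Fin n → ℤ) :
    AddSubgroup (MvPolynomial (Fin n) k ⧸ K) :=
  (polyPart k n a).toAddSubgroup.map (Submodule.mkQ K).toAddMonoidHom

/-- The module `I/J`, for ideals `J ⊆ I`. -/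
abbrev IdealQuot (I J : Ideal (MvPolynomial (Fin n) k)) : Type u := I ⧸ J.submoduleOf I

/-- The induced grading of `I/J`, for monomial ideals `J ⊆ I`: the part of degree `a` consists of
the classes of the elements of `I` that are homogeneous of degree `a`. -/
def idealQuotPart (I J : Ideal (MvPolynomial (Fin n) k)) (a : Fin n → ℤ) :
    AddSubgroup (IdealQuot I J) :=
  ((polyPart k n a).toAddSubgroup.comap I.subtype.toAddMonoidHom).map
    (J.submoduleOf I).mkQ.toAddMonoidHom

/-! ### Multigraded local cohomology

`H^i_𝔪(M)` is Mathlib's local cohomology, the direct limit over `t` of `Ext^i_S(S/𝔪^t, M)`. As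
usual, the grading of `Ext^i_S(N, M)` for multigraded `N`, `M` (`N` finitely generated) is obtained
from a multigraded projective resolution `P` of `N`: the part of degree `a` consists of the classes
of the cocycles `P_i → M` that are homogeneous of degree `a`. The grading of the direct limit is the
one induced by the gradings of the terms. -/

/-- A multigraded projective resolution of `S/K`: a projective resolution whose terms are
multigraded, with differentials and augmentation of degree `0`. -/
structure IsGradedResolution {K : Ideal (MvPolynomial (Fin n) k)}
    (P : ProjectiveResolution (ModuleCat.of (MvPolynomial (Fin n) k) (MvPolynomial (Fin n) k ⧸ K)))
    (𝓟 : (i : ℕ) → (Fin n → ℤ) → AddSubgroup (P.complex.X i)) : Prop where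
  multigrading : ∀ i, IsMultigrading (k := k) (𝓟 i)
  d_mem : ∀ (i j : ℕ) (b : Fin n → ℤ) (p : P.complex.X i), p ∈ 𝓟 i b →
    (P.complex.d i j).hom p ∈ 𝓟 j b
  π_mem : ∀ (b : Fin n → ℤ) (p : P.complex.X 0), p ∈ 𝓟 0 b →
    (P.π.f 0 ≫ (HomologicalComplex.singleObjXSelf (ComplexShape.down ℕ) 0
      (ModuleCat.of (MvPolynomial (Fin n) k) (MvPolynomial (Fin n) k ⧸ K))).hom).hom p
        ∈ quotPart K b

/-- `e ∈ Ext^i(N, M)` is the class of the map `f : P_i → M`, which is then a cocycle of `Hom(P, M)`,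
for a projective resolution `P` of `N`. -/
def IsExtClass {S : Type u} [CommRing S] {N M : ModuleCat.{u} S} (P : ProjectiveResolution N)
    {i : ℕ} (f : P.complex.X i ⟶ M) (e : ((Ext S (ModuleCat.{u} S) i).obj (op N)).obj M) : Prop :=
  ∃ z : (P.complex.linearYonedaObj S M).cycles i,
    ((P.complex.linearYonedaObj S M).iCycles i).hom z = f ∧
    ((P.complex.linearYonedaObj S M).homologyπ i).hom z = (P.isoExt i M).hom.hom e

/-- The canonical map `Ext^i(S/𝔞^t, M) → H^i_𝔞(M)`. -/
def extToLocalCohomology {S : Type u} [CommRing S] (𝔞 : Ideal S) (i t : ℕ) (M : ModuleCat.{u} S) :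
    ((Ext S (ModuleCat.{u} S) i).obj (op (ModuleCat.of S (S ⧸ 𝔞 ^ t)))).obj M ⟶
      (localCohomology 𝔞 i).obj M :=
  (Limits.colimit.ι (localCohomology.diagram (localCohomology.idealPowersDiagram 𝔞) i)
    (op (op t))).app M

/-- `h ∈ H^i_𝔪(M)` is homogeneous of degree `a`: for some `t`, it is the image of an element of
`Ext^i(S/𝔪^t, M)` represented by a homogeneous cocycle of degree `a` on a multigraded projective
resolution of `S/𝔪^t`. -/
def IsHomogeneousClass (M : ModuleCat.{u} (MvPolynomial (Fin n) k))
    (𝓜 : (Fin n → ℤ) → AddSubgroup M) (i : ℕ) (a : Fin n → ℤ)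
    (h : (localCohomology (MvPolynomial.idealOfVars (Fin n) k) i).obj M) : Prop :=
  ∃ (t : ℕ) (P : ProjectiveResolution (ModuleCat.of (MvPolynomial (Fin n) k)
      (MvPolynomial (Fin n) k ⧸ MvPolynomial.idealOfVars (Fin n) k ^ t)))
    (𝓟 : (i : ℕ) → (Fin n → ℤ) → AddSubgroup (P.complex.X i))
    (f : P.complex.X i ⟶ M)
    (e : ((Ext (MvPolynomial (Fin n) k) (ModuleCat.{u} (MvPolynomial (Fin n) k)) i).obj
      (op (ModuleCat.of (MvPolynomial (Fin n) k)
        (MvPolynomial (Fin n) k ⧸ MvPolynomial.idealOfVars (Fin n) k ^ t)))).obj M),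
    IsGradedResolution P 𝓟 ∧
    (∀ (b : Fin n → ℤ) (p : P.complex.X i), p ∈ 𝓟 i b → f.hom p ∈ 𝓜 (b + a)) ∧
    IsExtClass P f e ∧
    (extToLocalCohomology (MvPolynomial.idealOfVars (Fin n) k) i t M).hom e = h

/-- The part of degree `a` of `H^i_𝔪(M)`, as a `k`-subspace. (The homogeneous classes already form
a subspace, so that the span adds nothing.) -/
def localCohomologyPart (M : ModuleCat.{u} (MvPolynomial (Fin n) k))
    (𝓜 : (Fin n → ℤ) → AddSubgroup M) (i : ℕ) (a : Fin n → ℤ) :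
    Submodule k ((ModuleCat.restrictScalars (MvPolynomial.C : k →+* MvPolynomial (Fin n) k)).obj
      ((localCohomology (MvPolynomial.idealOfVars (Fin n) k) i).obj M)) :=
  Submodule.span k {h | IsHomogeneousClass M 𝓜 i a h}

/-- `H^i_𝔪(M)_a` as a `k`-vector space, for all `i ∈ ℤ`; it is zero for `i < 0`. -/
def GradedLocalCohomology (M : ModuleCat.{u} (MvPolynomial (Fin n) k))
    (𝓜 : (Fin n → ℤ) → AddSubgroup M) : (i : ℤ) → (a : Fin n → ℤ) → ModuleCat.{u} k
  | Int.ofNat i, a => ModuleCat.of k (localCohomologyPart M 𝓜 i a)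
  | Int.negSucc _, _ => ModuleCat.of k PUnit

end Graded

end RelativeTakayama

end

/-!
# The multigraded local cohomology of `I/J` by degree complexes

The powers of `𝔪` and the ideals `(x_1^s, …, x_n^s)` are cofinal, so `H^i_𝔪(I/J)` is the colimit
over `s` of the cohomology of `Hom(K(s), I/J)`, where `K(s)` is the Koszul complex on `x_1^s, …,
x_n^s`. The part of degree `a` of this cochain complex stabilizes for large `s`, and it can be
read off.

A homogeneous map of degree `a` from `K(s)` to `I/J` sends the basis element of `F ⊆ [n]` to the
degree `a + s ∑_{j ∈ F} e_j`. In this degree `I/J` is zero unless the exponent is nonnegative,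
which for large `s` means `G_a ⊆ F`, and it is then at most one-dimensional: it is nonzero iff the
monomial belongs to `I` and not to `J`. For large `s` this means that `F \ G_a` is a face of
`Δ_a(J)` and not of `Δ_a(I)` (`exists_shiftExp_mem_iff`). Hence a homogeneous map amounts to a
relative cochain on `(Δ_a(J), Δ_a(I))`, its `strand`. Up to the signs `faceSign`, which compare
the orientations of `F` and of `F ∪ G_a`, the Koszul differential becomes the simplicial
coboundary (`strand_comp_taylorDiff`): a facet that drops an element of `G_a` does not contribute,
as the exponent is too small. The strand is compatible with the maps `K(s') → K(s)`
(`strand_comp_taylorMap`), so the colimit is constant from some exponent `T` on, and sending a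
cocycle to its class induces the isomorphism (`ker_cocycleClass`, `range_cocycleClass`).

The grading of local cohomology is defined by arbitrary multigraded resolutions of `S/𝔪^t`. They
are compared with Koszul complexes through Taylor complexes: the Taylor complex of an arbitrary
well-ordered family of monomials is exact by an explicit contracting homotopy (`taylorD_taylorH`),
so it is a multigraded resolution by free modules, and the components of degree `0` of a lift from
it to another multigraded resolution again form a lift (`exists_graded_lift`). The Koszul
complexes are the Taylor complexes of `x_1^s, …, x_n^s`.

If `∏_{j ∈ G_a} x_j` belongs to `√J`, then a minimal generator of `J` involves only variables in
`G_a`, so that `Δ_a(J)` has no face, and all cochain groups vanish.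
-/

noncomputable section

namespace RelativeTakayama

/-! ### Classes in `Ext` and cocycles on projective resolutions -/

section ExtClasses

variable {S : Type u} [CommRing S]

/-- The map `Hom(Y, M) → Hom(X, M)` of cochain complexes induced by a chain map `X → Y`. -/
def linearYonedaMap {X Y : ChainComplex (ModuleCat.{u} S) ℕ} (φ : X ⟶ Y) (M : ModuleCat.{u} S) :
    Y.linearYonedaObj S M ⟶ X.linearYonedaObj S M :=
  (HomologicalComplex.unopFunctor _ _).map
    (((((linearYoneda S (ModuleCat.{u} S)).obj M).rightOp.mapHomologicalComplex _).map φ).op)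

theorem comp_iso_inv_eq {C : Type*} [Category C] {X X' Y Y' Z Z' : C} {A : X ⟶ X'}
    {p : X' ⟶ Y'} {q : X ⟶ Y} {B : Y ⟶ Y'} (h1 : A ≫ p = q ≫ B) (e : Z ≅ Y) (e' : Z' ≅ Y')
    {D : Z ⟶ Z'}
    (h2 : e.hom ≫ B = D ≫ e'.hom) : A ≫ p ≫ e'.inv = (q ≫ e.inv) ≫ D := by
  rw [← Category.assoc, h1, Category.assoc, Category.assoc, ← (Iso.inv_comp_eq e).2 h2.symm]
  simp

/-- Under `ProjectiveResolution.isoExt`, the contravariant functoriality of `Ext` is given by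
lifts to projective resolutions. -/
theorem isoExt_naturality {N N' : ModuleCat.{u} S} (g : N ⟶ N') (P : ProjectiveResolution N)
    (Q : ProjectiveResolution N') (φ : P.complex ⟶ Q.complex)
    (comm : φ.f 0 ≫ Q.π.f 0 = P.π.f 0 ≫ g) (i : ℕ) (M : ModuleCat.{u} S) :
    ((Ext S (ModuleCat.{u} S) i).map g.op).app M ≫ (P.isoExt i M).hom =
      (Q.isoExt i M).hom ≫ HomologicalComplex.homologyMap (linearYonedaMap φ M) i := by
  -- `Ext` is the opposite of a left derived functor and `isoExt` is composed of the opposite of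
  -- `isoLeftDerivedObj` and of `homologyOp`; each of the two is natural.
  have h1 := congrArg Quiver.Hom.unop (ProjectiveResolution.isoLeftDerivedObj_inv_naturality g P Q φ
    comm ((linearYoneda S (ModuleCat.{u} S)).obj M).rightOp i)
  have h2 := congrArg Quiver.Hom.unop
    (HomologicalComplex.homologyOp_hom_naturality (linearYonedaMap φ M) i)
  let βP := ((P.complex.linearYonedaObj S M).homologyOp i).unop
  let βQ := ((Q.complex.linearYonedaObj S M).homologyOp i).unop
  exact comp_iso_inv_eq h1 βQ βP h2

theorem isExtClass_cocycle {N M : ModuleCat.{u} S} {P : ProjectiveResolution N}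
    {i : ℕ} {f : P.complex.X i ⟶ M} {e : ((Ext S (ModuleCat.{u} S) i).obj (op N)).obj M}
    (h : IsExtClass P f e) (j : ℕ) : P.complex.d j i ≫ f = 0 := by
  obtain ⟨z, rfl, -⟩ := h
  have := (P.complex.linearYonedaObj S M).iCycles_d i j
  exact congrArg (fun x => x.hom z) this

theorem exists_cycle {N M : ModuleCat.{u} S} (P : ProjectiveResolution N)
    {i : ℕ} (f : P.complex.X i ⟶ M) (hf : P.complex.d (i + 1) i ≫ f = 0) :
    ∃ z : (P.complex.linearYonedaObj S M).cycles i,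
      ((P.complex.linearYonedaObj S M).iCycles i).hom z = f := by
  let K := P.complex.linearYonedaObj S M
  have hk : (ModuleCat.ofHom (LinearMap.toSpanSingleton S (K.X i) f)) ≫ K.d i (i + 1) = 0 := by
    apply ModuleCat.hom_ext
    apply LinearMap.ext_ring
    refine (congrArg (K.d i (i + 1)).hom (one_smul S (show K.X i from f))).trans ?_
    exact hf
  refine ⟨(K.liftCycles _ (i + 1) (by simp) hk).hom 1, ?_⟩
  have := K.liftCycles_i _ (i + 1) (by simp) hk
  have := congrArg (fun x => x.hom 1) this
  exact this.trans (one_smul S (show K.X i from f))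

theorem exists_isExtClass {N M : ModuleCat.{u} S} (P : ProjectiveResolution N)
    {i : ℕ} (f : P.complex.X i ⟶ M) (hf : P.complex.d (i + 1) i ≫ f = 0) :
    ∃ e, IsExtClass P f e := by
  obtain ⟨z, hz⟩ := exists_cycle P f hf
  refine ⟨(P.isoExt i M).inv.hom (((P.complex.linearYonedaObj S M).homologyπ i).hom z), z, hz, ?_⟩
  simp

theorem IsExtClass.add {N M : ModuleCat.{u} S} {P : ProjectiveResolution N}
    {i : ℕ} {f f' : P.complex.X i ⟶ M} {e e' : ((Ext S (ModuleCat.{u} S) i).obj (op N)).obj M}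
    (h : IsExtClass P f e) (h' : IsExtClass P f' e') : IsExtClass P (f + f') (e + e') := by
  obtain ⟨z, hz, h⟩ := h
  obtain ⟨z', hz', h'⟩ := h'
  exact ⟨z + z', (map_add _ z z').trans (congrArg₂ (· + ·) hz hz'), by rw [map_add, map_add, h, h']⟩

theorem IsExtClass.smul {N M : ModuleCat.{u} S} {P : ProjectiveResolution N}
    {i : ℕ} {f : P.complex.X i ⟶ M} {e : ((Ext S (ModuleCat.{u} S) i).obj (op N)).obj M}
    (h : IsExtClass P f e) (r : S) : IsExtClass P (r • f) (r • e) := by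
  obtain ⟨z, hz, h⟩ := h
  exact ⟨r • z, (map_smul _ r z).trans (congrArg (r • ·) hz), by rw [map_smul, map_smul, h]⟩

/-- A class vanishes iff its cocycle is a coboundary. If `j + 1 ≠ i`, then `d i j = 0` and the
condition says that the cocycle is zero. -/
theorem IsExtClass.eq_zero_iff {N M : ModuleCat.{u} S} {P : ProjectiveResolution N}
    {i : ℕ} {f : P.complex.X i ⟶ M} {e : ((Ext S (ModuleCat.{u} S) i).obj (op N)).obj M}
    (h : IsExtClass P f e) :
    e = 0 ↔ ∃ (j : ℕ) (g : P.complex.X j ⟶ M), f = P.complex.d i j ≫ g := by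
  obtain ⟨z, rfl, h⟩ := h
  let K := P.complex.linearYonedaObj S M
  have h0 : e = 0 ↔ (K.homologyπ i).hom z = 0 := by
    rw [h]
    constructor
    · rintro rfl; simp
    · intro hh
      simpa using congrArg (P.isoExt i M).inv.hom hh
  rw [h0]
  constructor
  · intro hz
    have hex : (ShortComplex.mk _ _
        (K.toCycles_comp_homologyπ ((ComplexShape.up ℕ).prev i) i)).Exact :=
      ShortComplex.exact_of_g_is_cokernel _ (K.homologyIsCokernel _ i rfl)
    obtain ⟨g, hg⟩ := (ShortComplex.moduleCat_exact_iff _).1 hex z hz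
    refine ⟨_, g, ?_⟩
    rw [← hg]
    have := K.toCycles_i ((ComplexShape.up ℕ).prev i) i
    exact congrArg (fun x => x.hom g) this
  · rintro ⟨j, g, hg⟩
    have h1 : z = (K.toCycles j i).hom g := by
      apply (ModuleCat.mono_iff_injective (K.iCycles i)).1 inferInstance
      refine hg.trans ?_
      have := K.toCycles_i j i
      exact (congrArg (fun x => x.hom g) this).symm
    rw [h1]
    exact congrArg (fun x => x.hom g) (K.toCycles_comp_homologyπ j i)

theorem IsExtClass.map {N N' M : ModuleCat.{u} S} {g : N ⟶ N'} {P : ProjectiveResolution N}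
    {Q : ProjectiveResolution N'} {φ : P.complex ⟶ Q.complex}
    (comm : φ.f 0 ≫ Q.π.f 0 = P.π.f 0 ≫ g) {i : ℕ} {f : Q.complex.X i ⟶ M}
    {e : ((Ext S (ModuleCat.{u} S) i).obj (op N')).obj M} (h : IsExtClass Q f e) :
    IsExtClass P (φ.f i ≫ f) ((((Ext S (ModuleCat.{u} S) i).map g.op).app M).hom e) := by
  obtain ⟨z, rfl, h⟩ := h
  refine ⟨(HomologicalComplex.cyclesMap (linearYonedaMap φ M) i).hom z, ?_, ?_⟩
  · exact congrArg (fun x => x.hom z) (HomologicalComplex.cyclesMap_i (linearYonedaMap φ M) i)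
  · refine (congrArg (fun x => x.hom z)
      (HomologicalComplex.homologyπ_naturality (linearYonedaMap φ M) i)).symm.trans ?_
    refine Eq.trans ?_ (congrArg (fun x => x.hom e) (isoExt_naturality g P Q φ comm i M)).symm
    exact congrArg (HomologicalComplex.homologyMap (linearYonedaMap φ M) i).hom h

theorem IsExtClass.unique {N M : ModuleCat.{u} S} {P : ProjectiveResolution N}
    {i : ℕ} {f : P.complex.X i ⟶ M} {e e' : ((Ext S (ModuleCat.{u} S) i).obj (op N)).obj M}
    (h : IsExtClass P f e) (h' : IsExtClass P f e') : e = e' := by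
  obtain ⟨z, rfl, h⟩ := h
  obtain ⟨z', hz', h'⟩ := h'
  have := (ModuleCat.mono_iff_injective
    ((P.complex.linearYonedaObj S M).iCycles i)).1 inferInstance hz'
  subst this
  have := congrArg (P.isoExt i M).inv.hom (h.symm.trans h')
  simpa using this

end ExtClasses

/-! ### Classes in local cohomology -/

section LocalClasses

variable {S : Type u} [CommRing S]

/-- The surjection `S/K → S/K'` for ideals `K ⊆ K'`. -/
def quotMap {K K' : Ideal S} (h : K ≤ K') : ModuleCat.of S (S ⧸ K) ⟶ ModuleCat.of S (S ⧸ K') :=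
  ModuleCat.ofHom (Submodule.mapQ _ _ LinearMap.id h)

theorem quotMap_comp {K K' K'' : Ideal S} (h : K ≤ K') (h' : K' ≤ K'') :
    quotMap h ≫ quotMap h' = quotMap (h.trans h') := by
  apply ModuleCat.hom_ext
  apply Submodule.linearMap_qext
  rfl

/-- The map `Ext^i(S/K', M) → Ext^i(S/K, M)` for ideals `K ⊆ K'`. -/
def extQuotMap {K K' : Ideal S} (h : K ≤ K') (i : ℕ) (M : ModuleCat.{u} S) :
    ((Ext S (ModuleCat.{u} S) i).obj (op (ModuleCat.of S (S ⧸ K')))).obj M →ₗ[S]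
      ((Ext S (ModuleCat.{u} S) i).obj (op (ModuleCat.of S (S ⧸ K)))).obj M :=
  (((Ext S (ModuleCat.{u} S) i).map (quotMap h).op).app M).hom

theorem extQuotMap_comp {K K' K'' : Ideal S} (h : K ≤ K') (h' : K' ≤ K'') (i : ℕ)
    (M : ModuleCat.{u} S) (e) :
    extQuotMap h i M (extQuotMap h' i M e) = extQuotMap (h.trans h') i M e := by
  simp only [extQuotMap, ← quotMap_comp h h', op_comp, Functor.map_comp, NatTrans.comp_app,
    ModuleCat.hom_comp, LinearMap.comp_apply]

theorem extToLocalCohomology_extQuotMap (𝔞 : Ideal S) (i : ℕ) {t s : ℕ} (hts : t ≤ s)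
    (M : ModuleCat.{u} S) (e) :
    (extToLocalCohomology 𝔞 i s M).hom (extQuotMap (Ideal.pow_le_pow_right hts) i M e) =
      (extToLocalCohomology 𝔞 i t M).hom e := by
  have h := Limits.colimit.w (localCohomology.diagram (localCohomology.idealPowersDiagram 𝔞) i)
    (homOfLE hts).op.op
  have h := congrArg (fun x => (x.app M).hom e) h
  exact h

/-- A class of `Ext^i(S/𝔞^t, M)` that dies in the colimit dies at a finite stage. -/
theorem extToLocalCohomology_eq_zero (𝔞 : Ideal S) (i t : ℕ) (M : ModuleCat.{u} S) (e)
    (h : (extToLocalCohomology 𝔞 i t M).hom e = 0) :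
    ∃ (s : ℕ) (hts : t ≤ s), extQuotMap (Ideal.pow_le_pow_right (I := 𝔞) hts) i M e = 0 := by
  have : Limits.PreservesFilteredColimitsOfSize.{0, 0} (forget (ModuleCat.{u} S)) :=
    Limits.preservesFilteredColimitsOfSize_shrink.{0, u, 0, u} _
  let D := localCohomology.diagram (localCohomology.idealPowersDiagram 𝔞) i
  let hc := Limits.isColimitOfPreserves ((evaluation _ _).obj M) (Limits.colimit.isColimit D)
  have h' : (((evaluation _ _).obj M).mapCocone (Limits.colimit.cocone D)).ι.app (op (op t)) e =
    (((evaluation _ _).obj M).mapCocone (Limits.colimit.cocone D)).ι.app (op (op t)) 0 := by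
    refine Eq.trans h (map_zero _).symm
  obtain ⟨k, f, g, hfg⟩ := Limits.Concrete.isColimit_exists_of_rep_eq _ hc _ _ h'
  refine ⟨k.unop.unop, leOfHom f.unop.unop, ?_⟩
  exact hfg.trans (map_zero _)

variable {𝔞 : Ideal S} {i : ℕ} {M : ModuleCat.{u} S}

/-- `h ∈ H^i_𝔞(M)` is the image of the class in `Ext^i(S/K, M)` of the cocycle `f : P_i → M`, where
`P` is a projective resolution of `S/K` for an ideal `K` that contains a power of `𝔞`. -/
def IsLocalClass {K : Ideal S} (P : ProjectiveResolution (ModuleCat.of S (S ⧸ K)))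
    (f : P.complex.X i ⟶ M) (h : (localCohomology 𝔞 i).obj M) : Prop :=
  ∃ (t : ℕ) (ht : 𝔞 ^ t ≤ K) (e : _), IsExtClass P f e ∧
    (extToLocalCohomology 𝔞 i t M).hom (extQuotMap ht i M e) = h

/-- The image in local cohomology of a class on `S/K` does not depend on the power of `𝔞` in `K`. -/
theorem extToLocalCohomology_extQuotMap_eq {K : Ideal S} {t s : ℕ} (ht : 𝔞 ^ t ≤ K)
    (hs : 𝔞 ^ s ≤ K) (e) :
    (extToLocalCohomology 𝔞 i t M).hom (extQuotMap ht i M e) =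
      (extToLocalCohomology 𝔞 i s M).hom (extQuotMap hs i M e) := by
  rw [← extToLocalCohomology_extQuotMap 𝔞 i (le_max_left t s),
    ← extToLocalCohomology_extQuotMap 𝔞 i (le_max_right t s), extQuotMap_comp, extQuotMap_comp]

theorem IsLocalClass.exists_of_le {K : Ideal S} {P : ProjectiveResolution (ModuleCat.of S (S ⧸ K))}
    {f : P.complex.X i ⟶ M} {h : (localCohomology 𝔞 i).obj M} (hf : IsLocalClass P f h)
    {t : ℕ} (ht : 𝔞 ^ t ≤ K) : ∃ e, IsExtClass P f e ∧
    (extToLocalCohomology 𝔞 i t M).hom (extQuotMap ht i M e) = h := by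
  obtain ⟨s, hs, e, he, rfl⟩ := hf
  exact ⟨e, he, extToLocalCohomology_extQuotMap_eq _ _ _⟩

theorem IsLocalClass.unique {K : Ideal S} {P : ProjectiveResolution (ModuleCat.of S (S ⧸ K))}
    {f : P.complex.X i ⟶ M} {h h' : (localCohomology 𝔞 i).obj M} (hf : IsLocalClass P f h)
    (hf' : IsLocalClass P f h') : h = h' := by
  obtain ⟨s, hs, e, he, rfl⟩ := hf
  obtain ⟨e', he', rfl⟩ := hf'.exists_of_le hs
  rw [he.unique he']

theorem IsLocalClass.add {K : Ideal S} {P : ProjectiveResolution (ModuleCat.of S (S ⧸ K))}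
    {f f' : P.complex.X i ⟶ M} {h h' : (localCohomology 𝔞 i).obj M} (hf : IsLocalClass P f h)
    (hf' : IsLocalClass P f' h') : IsLocalClass P (f + f') (h + h') := by
  obtain ⟨s, hs, e, he, rfl⟩ := hf
  obtain ⟨e', he', rfl⟩ := hf'.exists_of_le hs
  exact ⟨s, hs, _, he.add he', by rw [map_add, map_add]⟩

theorem IsLocalClass.smul {K : Ideal S} {P : ProjectiveResolution (ModuleCat.of S (S ⧸ K))}
    {f : P.complex.X i ⟶ M} {h : (localCohomology 𝔞 i).obj M} (hf : IsLocalClass P f h)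
    (r : S) : IsLocalClass P (r • f) (r • h) := by
  obtain ⟨s, hs, e, he, rfl⟩ := hf
  exact ⟨s, hs, _, he.smul r, by rw [map_smul, map_smul]⟩

theorem exists_isLocalClass {K : Ideal S} (P : ProjectiveResolution (ModuleCat.of S (S ⧸ K)))
    (f : P.complex.X i ⟶ M) (hf : P.complex.d (i + 1) i ≫ f = 0) {t : ℕ} (ht : 𝔞 ^ t ≤ K) :
    ∃ h : (localCohomology 𝔞 i).obj M, IsLocalClass P f h := by
  obtain ⟨e, he⟩ := exists_isExtClass P f hf
  exact ⟨_, t, ht, e, he, rfl⟩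

/-- A chain map over `S/K → S/K'` takes a cocycle to a cocycle with the same local class. -/
theorem IsLocalClass.map {K K' : Ideal S} {P : ProjectiveResolution (ModuleCat.of S (S ⧸ K))}
    {Q : ProjectiveResolution (ModuleCat.of S (S ⧸ K'))} (hK : K ≤ K')
    {φ : P.complex ⟶ Q.complex} (comm : φ.f 0 ≫ Q.π.f 0 = P.π.f 0 ≫ quotMap hK)
    {f : Q.complex.X i ⟶ M} {h : (localCohomology 𝔞 i).obj M} (hf : IsLocalClass Q f h)
    {t : ℕ} (ht : 𝔞 ^ t ≤ K) : IsLocalClass P (φ.f i ≫ f) h := by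
  obtain ⟨e, he, rfl⟩ := hf.exists_of_le (ht.trans hK)
  refine ⟨t, ht, _, he.map comm, ?_⟩
  exact congrArg _ (extQuotMap_comp ht hK i M e)

theorem IsLocalClass.of_boundary {K : Ideal S}
    {P : ProjectiveResolution (ModuleCat.of S (S ⧸ K))} {h : (localCohomology 𝔞 i).obj M} {j : ℕ}
    (g : P.complex.X j ⟶ M) (hf : IsLocalClass P (P.complex.d i j ≫ g) h) : h = 0 := by
  obtain ⟨s, hs, e, he, rfl⟩ := hf
  rw [he.eq_zero_iff.2 ⟨j, g, rfl⟩, map_zero, map_zero]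

/-- If the local class of a cocycle vanishes, the cocycle becomes a coboundary on the resolutions of
`S/K` for all small enough `K`. -/
theorem IsLocalClass.exists_boundary {K : Ideal S}
    {P : ProjectiveResolution (ModuleCat.of S (S ⧸ K))} {f : P.complex.X i ⟶ M}
    (hf : IsLocalClass P f (0 : (localCohomology 𝔞 i).obj M)) :
    ∃ t : ℕ, ∀ (K' : Ideal S) (_ : K' ≤ 𝔞 ^ t) (hK : K' ≤ K)
      (Q : ProjectiveResolution (ModuleCat.of S (S ⧸ K'))) (φ : Q.complex ⟶ P.complex)
      (_ : φ.f 0 ≫ P.π.f 0 = Q.π.f 0 ≫ quotMap hK),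
      ∃ (j : ℕ) (g : Q.complex.X j ⟶ M), φ.f i ≫ f = Q.complex.d i j ≫ g := by
  obtain ⟨s, hs, e, he, h0⟩ := hf
  obtain ⟨t, hst, ht⟩ := extToLocalCohomology_eq_zero _ _ _ _ _ h0
  refine ⟨t, fun K' hK't hK Q φ comm => ?_⟩
  have h1 := he.map comm
  refine h1.eq_zero_iff.1 ?_
  change extQuotMap hK i M e = 0
  rw [extQuotMap_comp] at ht
  rw [← extQuotMap_comp hK't ((Ideal.pow_le_pow_right hst).trans hs), ht, map_zero]

end LocalClasses

/-! ### The Taylor differential and its contracting homotopy -/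

section Taylor

variable (k : Type u) [Field k] {n : ℕ} {ι : Type} [LinearOrder ι]

/-- The number of elements of `F` below `v`. -/
def pos (F : Finset ι) (v : ι) : ℕ := (F.filter (· < v)).card

theorem pos_erase_of_lt {F : Finset ι} {u v : ι} (h : u < v) : pos (F.erase v) u = pos F u := by
  unfold pos
  congr 1
  ext x
  simp only [Finset.mem_filter, Finset.mem_erase]
  exact ⟨fun hx => ⟨hx.1.2, hx.2⟩, fun hx => ⟨⟨(hx.2.trans h).ne, hx.1⟩, hx.2⟩⟩

theorem pos_erase_add_one {F : Finset ι} {u v : ι} (hu : u ∈ F) (h : u < v) :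
    pos (F.erase u) v + 1 = pos F v := by
  unfold pos
  rw [Finset.filter_erase, Finset.card_erase_add_one]
  simp [hu, h]

theorem pos_insert {F : Finset ι} {w v : ι} (hw : w ∉ F) (h : w < v) :
    pos (insert w F) v = pos F v + 1 := by
  rw [← pos_erase_add_one (Finset.mem_insert_self w F) h, Finset.erase_insert hw]

theorem pos_eq_zero {F : Finset ι} {w : ι} (h : ∀ v ∈ F, w ≤ v) : pos F w = 0 := by
  unfold pos
  rw [Finset.card_eq_zero, Finset.filter_eq_empty_iff]
  exact fun v hv => (h v hv).not_gt

variable (β : ι → Fin n →₀ ℕ)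

/-- The Taylor differential of the monomials `x^(β v)`, on the free module on all finite subsets of
`ι`: `e_F ↦ ∑ ± (x_F / x_{F \ v}) e_{F \ v}`, where `x_F` is the least common multiple of the
`x^(β v)` for `v ∈ F`. All homological degrees are put together. -/
def taylorD : (Finset ι →₀ MvPolynomial (Fin n) k) →ₗ[MvPolynomial (Fin n) k]
    (Finset ι →₀ MvPolynomial (Fin n) k) :=
  Finsupp.lsum (MvPolynomial (Fin n) k) fun F => LinearMap.toSpanSingleton _ _
    (∑ v ∈ F, Finsupp.single (F.erase v)
      (MvPolynomial.monomial (F.sup β - (F.erase v).sup β) ((-1 : k) ^ pos F v)))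

variable {k}

theorem sup_erase_le (F : Finset ι) (v : ι) : (F.erase v).sup β ≤ F.sup β :=
  Finset.sup_mono (Finset.erase_subset _ _)

theorem taylorD_single (F : Finset ι) (m : Fin n →₀ ℕ) (r : k) :
    taylorD k β (Finsupp.single F (MvPolynomial.monomial m r)) =
      ∑ v ∈ F, Finsupp.single (F.erase v)
        (MvPolynomial.monomial (m + F.sup β - (F.erase v).sup β) ((-1 : k) ^ pos F v * r)) := by
  rw [taylorD, Finsupp.lsum_single, LinearMap.toSpanSingleton_apply, Finset.smul_sum]
  refine Finset.sum_congr rfl fun v _ => ?_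
  rw [Finsupp.smul_single, smul_eq_mul, MvPolynomial.monomial_mul, mul_comm r,
    add_tsub_assoc_of_le (sup_erase_le β F v)]

theorem taylorD_taylorD (x : Finset ι →₀ MvPolynomial (Fin n) k) :
    taylorD k β (taylorD k β x) = 0 := by
  suffices h : taylorD k β ∘ₗ taylorD k β = 0 from LinearMap.congr_fun h x
  refine Finsupp.lhom_ext' fun F => LinearMap.ext_ring ?_
  simp only [LinearMap.comp_apply, Finsupp.lsingle_apply, LinearMap.zero_apply]
  have h1 : (1 : MvPolynomial (Fin n) k) = MvPolynomial.monomial 0 1 := rfl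
  rw [h1, taylorD_single, map_sum]
  simp only [taylorD_single]
  rw [Finset.sum_sigma']
  -- The terms that remove `v, u` and `u, v` have the same monomial and opposite signs.
  refine Finset.sum_involution (fun p _ => ⟨p.2, p.1⟩) ?_ ?_ ?_ ?_
  · rintro ⟨v, u⟩ hp
    simp only [Finset.mem_sigma, Finset.mem_erase] at hp
    obtain ⟨hv, huv, hu⟩ := hp
    have key : ∀ u v : ι, u ∈ F → v ∈ F → u < v →
        (-1 : k) ^ pos (F.erase v) u * ((-1 : k) ^ pos F v * 1) +
          (-1 : k) ^ pos (F.erase u) v * ((-1 : k) ^ pos F u * 1) = 0 := by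
      intro u v hu hv h
      rw [pos_erase_of_lt h, ← pos_erase_add_one hu h, pow_succ]
      ring
    simp only [zero_add]
    rw [tsub_add_cancel_of_le (sup_erase_le β F v), tsub_add_cancel_of_le (sup_erase_le β F u),
      Finset.erase_right_comm, ← Finsupp.single_add, ← map_add]
    rcases lt_or_gt_of_ne huv with h | h
    · rw [key u v hu hv h, map_zero, Finsupp.single_zero]
    · rw [add_comm, key v u hv hu h, map_zero, Finsupp.single_zero]
  · rintro ⟨v, u⟩ hp - h
    simp only [Finset.mem_sigma, Finset.mem_erase] at hp
    simp only [Sigma.mk.injEq] at h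
    exact hp.2.1 h.1
  · rintro ⟨v, u⟩ hp
    simp only [Finset.mem_sigma, Finset.mem_erase] at hp ⊢
    exact ⟨hp.2.2, hp.2.1.symm, hp.1⟩
  · intros
    rfl

variable [WellFoundedLT ι]

open Classical in
/-- The contracting homotopy: in the multidegree `c` it inserts the least `w` such that `x^(β w)`
divides `x^c`. Since `w` depends on `c`, it is only `k`-linear. -/
def taylorH : (Finset ι →₀ MvPolynomial (Fin n) k) →ₗ[k] (Finset ι →₀ MvPolynomial (Fin n) k) :=
  Finsupp.lsum k fun F => (MvPolynomial.basisMonomials (Fin n) k).constr k fun m =>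
    if h : {v | β v ≤ m + F.sup β}.Nonempty then
      let w := wellFounded_lt.min _ h
      if w ∈ F then 0 else Finsupp.single (insert w F)
        (MvPolynomial.monomial (m + F.sup β - (insert w F).sup β) 1)
    else 0

theorem taylorH_single (F : Finset ι) (m : Fin n →₀ ℕ) (r : k) {c : Fin n →₀ ℕ}
    (hc : m + F.sup β = c) (h : {v | β v ≤ c}.Nonempty) :
    taylorH β (Finsupp.single F (MvPolynomial.monomial m r)) =
      if wellFounded_lt.min _ h ∈ F then 0 else Finsupp.single (insert (wellFounded_lt.min _ h) F)
        (MvPolynomial.monomial (c - (insert (wellFounded_lt.min _ h) F).sup β) r) := by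
  subst hc
  have h1 : MvPolynomial.monomial m r = r • (MvPolynomial.basisMonomials (Fin n) k) m := by
    rw [MvPolynomial.coe_basisMonomials, MvPolynomial.smul_monomial, smul_eq_mul, mul_one]
  rw [taylorH, Finsupp.lsum_single, h1, map_smul, Module.Basis.constr_basis, dif_pos h]
  dsimp only
  split_ifs with h2
  · rw [smul_zero]
  · rw [Finsupp.smul_single, MvPolynomial.smul_monomial, smul_eq_mul, mul_one]

/-- The homotopy identity `dh + hd = 1` in positive homological degrees. -/
theorem taylorD_taylorH (F : Finset ι) (hF : F.Nonempty) (m : Fin n →₀ ℕ) :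
    taylorD k β (taylorH β (Finsupp.single F (MvPolynomial.monomial m 1))) +
      taylorH β (taylorD k β (Finsupp.single F (MvPolynomial.monomial m 1))) =
      Finsupp.single F (MvPolynomial.monomial m (1 : k)) := by
  obtain ⟨c, hc⟩ : ∃ c, m + F.sup β = c := ⟨_, rfl⟩
  have hβ : ∀ v ∈ F, β v ≤ c := fun v hv => (Finset.le_sup hv).trans (hc ▸ le_add_self)
  have h : {v | β v ≤ c}.Nonempty := ⟨hF.choose, hβ _ hF.choose_spec⟩
  rw [taylorH_single β F m 1 hc h, taylorD_single, map_sum]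
  have hc' : ∀ v, (m + F.sup β - (F.erase v).sup β) + (F.erase v).sup β = c := fun v => by
    rw [tsub_add_cancel_of_le ((sup_erase_le β F v).trans le_add_self), hc]
  simp only [taylorH_single β _ _ _ (hc' _) h]
  have hwmin : ∀ v, β v ≤ c → wellFounded_lt.min _ h ≤ v := fun v hv =>
    WellFounded.min_le _ hv
  have hw : β (wellFounded_lt.min _ h) ≤ c := wellFounded_lt.min_mem _ h
  generalize wellFounded_lt.min _ h = w at hwmin hw
  -- The sign of `w` is `1`, as `w` is least. If `w ∈ F`, only the facet `F \ w` contributes;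
  -- otherwise the facets of `insert w F` other than `F` cancel against the second summand.
  by_cases hwF : w ∈ F
  · rw [if_pos hwF, map_zero, zero_add, Finset.sum_eq_single_of_mem w hwF]
    · rw [if_neg (Finset.notMem_erase w F), Finset.insert_erase hwF,
        pos_eq_zero fun v hv => hwmin v (hβ v hv), ← hc, add_tsub_cancel_right]
      simp
    · intro v _ hvw
      rw [if_pos (Finset.mem_erase.2 ⟨hvw.symm, hwF⟩)]
  · have hsup : (insert w F).sup β ≤ c := by
      rw [Finset.sup_insert]
      exact sup_le hw (hc ▸ le_add_self)
    rw [if_neg hwF, taylorD_single, Finset.sum_insert hwF, Finset.erase_insert hwF, add_assoc,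
      ← Finset.sum_add_distrib, Finset.sum_eq_zero, add_zero, tsub_add_cancel_of_le hsup,
      pos_eq_zero fun v hv => ?_, ← hc, add_tsub_cancel_right]
    · simp
    · rcases Finset.mem_insert.1 hv with rfl | hv
      · exact le_rfl
      · exact hwmin v (hβ v hv)
    · intro v hv
      have hwv : w < v := lt_of_le_of_ne (hwmin v (hβ v hv)) fun h => hwF (h ▸ hv)
      rw [if_neg fun h => hwF (Finset.mem_of_mem_erase h), tsub_add_cancel_of_le hsup,
        Finset.erase_insert_of_ne hwv.ne, pos_insert hwF hwv, ← Finsupp.single_add,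
        ← map_add, pow_succ]
      simp

end Taylor

/-! ### The Taylor resolution -/

section Builder

variable {S : Type u} [CommRing S]

/-- An exact complex of projective modules with augmentation, as a projective resolution. -/
def resolutionOfExact {Z : ModuleCat.{u} S} (C : ChainComplex (ModuleCat.{u} S) ℕ)
    (hproj : ∀ i, Projective (C.X i)) (ε : C.X 0 ⟶ Z) (hε : C.d 1 0 ≫ ε = 0)
    (hsurj : Function.Surjective ε.hom)
    (h0 : ∀ x : C.X 0, ε.hom x = 0 → ∃ y, (C.d 1 0).hom y = x)
    (hex : ∀ (i : ℕ) (x : C.X (i + 1)), (C.d (i + 1) i).hom x = 0 →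
      ∃ y, (C.d (i + 2) (i + 1)).hom y = x) :
    ProjectiveResolution Z where
  complex := C
  projective := hproj
  π := (ChainComplex.toSingle₀Equiv _ _).symm ⟨ε, hε⟩
  quasiIso := ⟨fun n => by
    cases n with
    | zero =>
      rw [ChainComplex.quasiIsoAt₀_iff, ShortComplex.quasiIso_iff_of_zeros']
      · refine (ShortComplex.exact_and_epi_g_iff_of_iso
          (S₂ := ShortComplex.mk (C.d 1 0) ε hε) ?_).2
          ⟨(ShortComplex.moduleCat_exact_iff _).2 h0, (ModuleCat.epi_iff_surjective _).2 hsurj⟩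
        exact ShortComplex.isoMk (Iso.refl _) (Iso.refl _) (Iso.refl _)
          ((Category.id_comp _).trans (Category.comp_id _).symm)
          ((Category.id_comp _).trans (Category.comp_id _).symm)
      all_goals first | rfl | exact C.shape _ _ (by simp)
    | succ n =>
      rw [quasiIsoAt_iff_exactAt']
      · rw [HomologicalComplex.exactAt_iff' _ (n + 2) (n + 1) n (by simp) (by simp)]
        exact (ShortComplex.moduleCat_exact_iff _).2 (hex n)
      · apply ChainComplex.exactAt_succ_single_obj⟩

end Builder

section Taylor

variable {k : Type u} [Field k] {n : ℕ} {ι : Type}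

variable (k n ι) in
/-- The term of degree `i` of the Taylor complex: the free module on the subsets of `ι` with `i`
elements. -/
abbrev TaylorX (i : ℕ) : Type u := {F : Finset ι // F.card = i} →₀ MvPolynomial (Fin n) k

variable (k n ι) in
/-- The embedding into the free module on all finite subsets. -/
def taylorIncl (i : ℕ) : TaylorX k n ι i →ₗ[MvPolynomial (Fin n) k]
    (Finset ι →₀ MvPolynomial (Fin n) k) :=
  Finsupp.lmapDomain _ _ Subtype.val

variable (k n ι) in
/-- The projection from the free module on all finite subsets. -/
def taylorProj (i : ℕ) : (Finset ι →₀ MvPolynomial (Fin n) k) →ₗ[MvPolynomial (Fin n) k]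
    TaylorX k n ι i :=
  Finsupp.lcomapDomain Subtype.val Subtype.val_injective

theorem taylorIncl_single {i : ℕ} (F : {F : Finset ι // F.card = i}) (p : MvPolynomial (Fin n) k) :
    taylorIncl k n ι i (Finsupp.single F p) = Finsupp.single F.1 p :=
  Finsupp.mapDomain_single

theorem taylorProj_single {i : ℕ} (F : {F : Finset ι // F.card = i})
    (p : MvPolynomial (Fin n) k) :
    taylorProj k n ι i (Finsupp.single F.1 p) = Finsupp.single F p :=
  Finsupp.comapDomain_single _ _ _ _

theorem taylorProj_single_of_ne {i : ℕ} {F : Finset ι} (h : F.card ≠ i)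
    (p : MvPolynomial (Fin n) k) : taylorProj k n ι i (Finsupp.single F p) = 0 := by
  ext G : 1
  change Finsupp.single F p G.1 = 0
  exact Finsupp.single_eq_of_ne fun hG => h (hG ▸ G.2)

theorem taylorIncl_taylorProj_single {i : ℕ} {F : Finset ι} (h : F.card = i)
    (p : MvPolynomial (Fin n) k) :
    taylorIncl k n ι i (taylorProj k n ι i (Finsupp.single F p)) = Finsupp.single F p := by
  rw [taylorProj_single ⟨F, h⟩, taylorIncl_single]

theorem taylorIncl_injective (i : ℕ) : Function.Injective (taylorIncl k n ι i) :=
  Finsupp.mapDomain_injective Subtype.val_injective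

/-- Two `k`-linear maps on a free module over the polynomial ring agree if they do on the
monomial multiples of the basis. -/
theorem hom_ext_monomial {α : Type*} {N : Type*} [AddCommGroup N] [Module k N]
    {f g : (α →₀ MvPolynomial (Fin n) k) →ₗ[k] N}
    (h : ∀ F m, f (Finsupp.single F (MvPolynomial.monomial m 1)) =
      g (Finsupp.single F (MvPolynomial.monomial m 1))) : f = g := by
  refine Finsupp.lhom_ext' fun F => (MvPolynomial.basisMonomials (Fin n) k).ext fun m => ?_
  simpa using h F m

variable [LinearOrder ι] (β : ι → Fin n →₀ ℕ)

/-- The component `i → j` of the Taylor differential; it is zero unless `j + 1 = i`. -/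
def taylorDiff (i j : ℕ) : TaylorX k n ι i →ₗ[MvPolynomial (Fin n) k] TaylorX k n ι j :=
  taylorProj k n ι j ∘ₗ taylorD k β ∘ₗ taylorIncl k n ι i

theorem taylorIncl_taylorDiff (i : ℕ) (x : TaylorX k n ι (i + 1)) :
    taylorIncl k n ι i (taylorDiff β (i + 1) i x) = taylorD k β (taylorIncl k n ι (i + 1) x) := by
  suffices h : ((taylorIncl k n ι i ∘ₗ taylorDiff β (i + 1) i).restrictScalars k) =
    ((taylorD k β ∘ₗ taylorIncl k n ι (i + 1)).restrictScalars k) from LinearMap.congr_fun h x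
  refine hom_ext_monomial fun F m => ?_
  simp only [LinearMap.restrictScalars_apply, LinearMap.comp_apply, taylorDiff, taylorIncl_single,
    taylorD_single, map_sum]
  refine Finset.sum_congr rfl fun v hv => taylorIncl_taylorProj_single ?_ _
  rw [Finset.card_erase_of_mem hv, F.2, Nat.add_sub_cancel]

theorem taylorDiff_of_ne {i j : ℕ} (h : j + 1 ≠ i) : taylorDiff (k := k) β i j = 0 := by
  refine Finsupp.lhom_ext' fun F => LinearMap.ext_ring ?_
  have h1 : (1 : MvPolynomial (Fin n) k) = MvPolynomial.monomial 0 1 := rfl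
  simp only [LinearMap.comp_apply, taylorDiff, Finsupp.lsingle_apply, h1, taylorIncl_single,
    taylorD_single, map_sum, LinearMap.zero_apply]
  refine Finset.sum_eq_zero fun v hv => taylorProj_single_of_ne (fun h' => h ?_) _
  rw [← h', Finset.card_erase_add_one hv, F.2]

theorem taylorDiff_taylorDiff (i : ℕ) (x : TaylorX k n ι (i + 2)) :
    taylorDiff β (i + 1) i (taylorDiff β (i + 2) (i + 1) x) = 0 := by
  apply taylorIncl_injective
  rw [taylorIncl_taylorDiff, taylorIncl_taylorDiff, taylorD_taylorD, map_zero]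

theorem exists_taylorDiff_eq [WellFoundedLT ι] (i : ℕ) (x : TaylorX k n ι (i + 1))
    (hx : taylorDiff β (i + 1) i x = 0) : ∃ y, taylorDiff β (i + 2) (i + 1) y = x := by
  refine ⟨taylorProj k n ι (i + 2) (taylorH β (taylorIncl k n ι (i + 1) x)), ?_⟩
  apply taylorIncl_injective
  rw [taylorIncl_taylorDiff]
  -- The homotopy raises the number of elements by one.
  have h1 : taylorIncl k n ι (i + 2)
      (taylorProj k n ι (i + 2) (taylorH β (taylorIncl k n ι (i + 1) x))) =
      taylorH β (taylorIncl k n ι (i + 1) x) := by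
    suffices h : (taylorIncl k n ι (i + 2) ∘ₗ taylorProj k n ι (i + 2)).restrictScalars k ∘ₗ
      taylorH β ∘ₗ (taylorIncl k n ι (i + 1)).restrictScalars k =
      taylorH β ∘ₗ (taylorIncl k n ι (i + 1)).restrictScalars k from LinearMap.congr_fun h x
    refine hom_ext_monomial fun F m => ?_
    simp only [LinearMap.restrictScalars_apply, LinearMap.comp_apply, taylorIncl_single]
    have hF : F.1.Nonempty := Finset.card_pos.1 (by rw [F.2]; exact Nat.succ_pos i)
    rw [taylorH_single β F.1 m 1 rfl
      ⟨hF.choose, show β hF.choose ≤ _ from (Finset.le_sup hF.choose_spec).trans le_add_self⟩]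
    split_ifs with hw
    · rw [map_zero, map_zero]
    · exact taylorIncl_taylorProj_single (by rw [Finset.card_insert_of_notMem hw, F.2]) _
  have h2 : taylorD k β (taylorH β (taylorIncl k n ι (i + 1) x)) +
      taylorH β (taylorD k β (taylorIncl k n ι (i + 1) x)) = taylorIncl k n ι (i + 1) x := by
    suffices h : ((taylorD k β).restrictScalars k ∘ₗ taylorH β + taylorH β ∘ₗ
      (taylorD k β).restrictScalars k) ∘ₗ (taylorIncl k n ι (i + 1)).restrictScalars k =
      (taylorIncl k n ι (i + 1)).restrictScalars k from LinearMap.congr_fun h x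
    refine hom_ext_monomial fun F m => ?_
    simp only [LinearMap.restrictScalars_apply, LinearMap.comp_apply, taylorIncl_single,
      LinearMap.add_apply]
    exact taylorD_taylorH β F.1 (Finset.card_pos.1 (by rw [F.2]; exact Nat.succ_pos i)) m
  rw [← taylorIncl_taylorDiff, hx, map_zero, map_zero, add_zero] at h2
  rw [h1, h2]

variable (k) in
/-- The monomial ideal generated by the monomials `x^(β v)`. -/
def monomialSpan : Ideal (MvPolynomial (Fin n) k) :=
  Ideal.span (Set.range fun v => MvPolynomial.monomial (β v) (1 : k))

/-- The augmentation of the Taylor complex, which sends the basis element of `∅` to `1`. -/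
def taylorAug : TaylorX k n ι 0 →ₗ[MvPolynomial (Fin n) k]
    (MvPolynomial (Fin n) k ⧸ monomialSpan k β) :=
  Finsupp.lsum (MvPolynomial (Fin n) k) fun _ => (monomialSpan k β).mkQ

theorem taylorDiff_single (i : ℕ) (F : {F : Finset ι // F.card = i + 1}) (m : Fin n →₀ ℕ) (r : k) :
    taylorDiff β (i + 1) i (Finsupp.single F (MvPolynomial.monomial m r)) =
      ∑ v : {v // v ∈ F.1}, Finsupp.single
        ⟨F.1.erase v, by rw [Finset.card_erase_of_mem v.2, F.2, Nat.add_sub_cancel]⟩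
        (MvPolynomial.monomial (m + F.1.sup β - (F.1.erase v).sup β)
          ((-1 : k) ^ pos F.1 v.1 * r)) := by
  apply taylorIncl_injective
  rw [taylorIncl_taylorDiff, taylorIncl_single, taylorD_single, map_sum]
  simp only [taylorIncl_single]
  exact (Finset.sum_coe_sort F.1 fun v => Finsupp.single (F.1.erase v)
        (MvPolynomial.monomial (m + F.1.sup β - (F.1.erase v).sup β)
          ((-1 : k) ^ pos F.1 v * r))).symm

theorem taylorDiff_singleton (v : ι) :
    taylorDiff β 1 0 (Finsupp.single ⟨{v}, Finset.card_singleton v⟩ 1) =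
      Finsupp.single ⟨∅, Finset.card_empty⟩ (MvPolynomial.monomial (β v) (1 : k)) := by
  have h1 : (1 : MvPolynomial (Fin n) k) = MvPolynomial.monomial 0 1 := rfl
  apply taylorIncl_injective
  rw [taylorIncl_taylorDiff, taylorIncl_single, taylorIncl_single, h1, taylorD_single,
    Finset.sum_singleton]
  simp [pos_eq_zero, bot_eq_zero]

theorem taylorAug_taylorDiff (x : TaylorX k n ι 1) : taylorAug β (taylorDiff β 1 0 x) = 0 := by
  suffices h : taylorAug (k := k) β ∘ₗ taylorDiff β 1 0 = 0 from LinearMap.congr_fun h x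
  refine Finsupp.lhom_ext' fun F => LinearMap.ext_ring ?_
  obtain ⟨F, hF⟩ := F
  obtain ⟨v, rfl⟩ := Finset.card_eq_one.1 hF
  rw [LinearMap.comp_apply, LinearMap.comp_apply, Finsupp.lsingle_apply, taylorDiff_singleton,
    taylorAug, Finsupp.lsum_single, LinearMap.zero_comp, LinearMap.zero_apply,
    Submodule.mkQ_apply, Submodule.Quotient.mk_eq_zero]
  exact Ideal.subset_span ⟨v, rfl⟩

theorem exists_taylorDiff_eq_of_taylorAug (x : TaylorX k n ι 0) (hx : taylorAug β x = 0) :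
    ∃ y, taylorDiff β 1 0 y = x := by
  have hu : ∀ F : {F : Finset ι // F.card = 0}, F = ⟨∅, Finset.card_empty⟩ := fun F =>
    Subtype.ext (Finset.card_eq_zero.1 F.2)
  have hx' : x = Finsupp.single ⟨∅, Finset.card_empty⟩ (x ⟨∅, Finset.card_empty⟩) := by
    ext F : 1
    rw [hu F, Finsupp.single_eq_same]
  generalize x ⟨∅, Finset.card_empty⟩ = p at hx'
  subst hx'
  rw [taylorAug, Finsupp.lsum_single, Submodule.mkQ_apply, Submodule.Quotient.mk_eq_zero] at hx
  suffices h : monomialSpan k β ≤ (LinearMap.range (taylorDiff β 1 0)).comap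
    (Finsupp.lsingle ⟨∅, Finset.card_empty⟩) from h hx
  refine Submodule.span_le.2 ?_
  rintro _ ⟨v, rfl⟩
  exact ⟨_, taylorDiff_singleton β v⟩

/-- The Taylor complex of the monomials `x^(β v)`. -/
def taylorComplex : ChainComplex (ModuleCat.{u} (MvPolynomial (Fin n) k)) ℕ where
  X i := ModuleCat.of _ (TaylorX k n ι i)
  d i j := ModuleCat.ofHom (taylorDiff β i j)
  shape i j h := by rw [taylorDiff_of_ne β h]; rfl
  d_comp_d' := by
    rintro _ _ i rfl rfl
    exact ModuleCat.hom_ext (LinearMap.ext (taylorDiff_taylorDiff β i))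

variable [WellFoundedLT ι]

/-- The Taylor complex as a projective resolution of `S/(x^(β v))`. The index set may be infinite,
so that no finite generating set of a monomial ideal has to be chosen. -/
def taylorResolution : ProjectiveResolution
    (ModuleCat.of (MvPolynomial (Fin n) k) (MvPolynomial (Fin n) k ⧸ monomialSpan k β)) :=
  resolutionOfExact (taylorComplex β)
    (fun i => ModuleCat.projective_of_free (M := ModuleCat.of _ (TaylorX k n ι i))
      (Module.Free.chooseBasis (MvPolynomial (Fin n) k) (TaylorX k n ι i)))
    (ModuleCat.ofHom (taylorAug β)) (ModuleCat.hom_ext (LinearMap.ext (taylorAug_taylorDiff β)))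
    (fun y => by
      obtain ⟨p, rfl⟩ := (monomialSpan k β).mkQ_surjective y
      exact ⟨Finsupp.single ⟨∅, Finset.card_empty⟩ p, Finsupp.lsum_single _ _ _ _⟩)
    (exists_taylorDiff_eq_of_taylorAug β) (exists_taylorDiff_eq β)

theorem taylorResolution_π : (taylorResolution (k := k) β).π.f 0 = ModuleCat.ofHom (taylorAug β) :=
  ChainComplex.toSingle₀Equiv_symm_apply_f_zero _ _

end Taylor

/-! ### Multigradings and lifts that preserve degrees -/

section Internal

variable {I : Type*} [DecidableEq I] {M : Type*} [AddCommGroup M] {𝓜 : I → AddSubgroup M}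

/-- A family of subgroups that spans is a direct sum decomposition if there are maps that act on it
as the projections should. -/
theorem isInternal_of_projections (p : I → M →+ M) (h1 : ∀ b, ∀ x ∈ 𝓜 b, p b x = x)
    (h2 : ∀ b c, b ≠ c → ∀ x ∈ 𝓜 b, p c x = 0) (h3 : ⊤ ≤ iSup 𝓜) : DirectSum.IsInternal 𝓜 := by
  constructor
  · have key : ∀ (c : I) (y : DirectSum I fun i => 𝓜 i),
        p c (DirectSum.coeAddMonoidHom 𝓜 y) = y c := by
      intro c y
      induction y using DirectSum.induction_on with
      | zero => simp
      | of b x =>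
        rw [DirectSum.coeAddMonoidHom_of]
        by_cases hbc : b = c
        · subst hbc
          rw [DirectSum.of_eq_same, h1 b x x.2]
        · rw [DirectSum.of_eq_of_ne _ _ _ (Ne.symm hbc), h2 b c hbc x x.2]
          rfl
      | add x y hx hy => rw [map_add, map_add, hx, hy, DirectSum.add_apply, AddSubgroup.coe_add]
    intro y y' h
    refine DFinsupp.ext fun c => Subtype.ext ?_
    exact (key c y).symm.trans ((congrArg (p c) h).trans (key c y'))
  · have h4 : iSup 𝓜 ≤ (DirectSum.coeAddMonoidHom 𝓜).range := iSup_le fun b x hx =>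
      ⟨DirectSum.of (fun i => 𝓜 i) b ⟨x, hx⟩, DirectSum.coeAddMonoidHom_of _ _ _⟩
    exact fun x => h4 (h3 (AddSubgroup.mem_top x))

/-- The projection of a direct sum onto one of the summands. -/
def internalProj (h : DirectSum.IsInternal 𝓜) (b : I) : M →+ M :=
  ((𝓜 b).subtype.comp (DFinsupp.evalAddMonoidHom b)).comp
    (AddEquiv.ofBijective _ h).symm.toAddMonoidHom

theorem internal_induction (h : DirectSum.IsInternal 𝓜) {q : M → Prop} (h0 : q 0)
    (hadd : ∀ x y, q x → q y → q (x + y))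
    (hmem : ∀ b, ∀ x ∈ 𝓜 b, q x) (x : M) : q x := by
  obtain ⟨y, rfl⟩ := h.2 x
  induction y using DirectSum.induction_on with
  | zero => rw [map_zero]; exact h0
  | of b x => rw [DirectSum.coeAddMonoidHom_of]; exact hmem b x x.2
  | add x y hx hy => rw [map_add]; exact hadd _ _ hx hy

variable (h : DirectSum.IsInternal 𝓜)

theorem internalProj_mem (b : I) (x : M) : internalProj h b x ∈ 𝓜 b := Subtype.mem _

theorem internalProj_of_mem {b : I} {x : M} (hx : x ∈ 𝓜 b) : internalProj h b x = x := by
  have h1 : (AddEquiv.ofBijective _ h).symm x = DirectSum.of (fun i => 𝓜 i) b ⟨x, hx⟩ := by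
    rw [AddEquiv.symm_apply_eq]
    exact (DirectSum.coeAddMonoidHom_of 𝓜 b ⟨x, hx⟩).symm
  change (((AddEquiv.ofBijective _ h).symm x) b : M) = x
  rw [h1, DirectSum.of_eq_same]

theorem internalProj_of_ne {b c : I} (hbc : b ≠ c) {x : M} (hx : x ∈ 𝓜 b) :
    internalProj h c x = 0 := by
  have h1 : (AddEquiv.ofBijective _ h).symm x = DirectSum.of (fun i => 𝓜 i) b ⟨x, hx⟩ := by
    rw [AddEquiv.symm_apply_eq]
    exact (DirectSum.coeAddMonoidHom_of 𝓜 b ⟨x, hx⟩).symm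
  change (((AddEquiv.ofBijective _ h).symm x) c : M) = 0
  rw [h1, DirectSum.of_eq_of_ne _ _ _ hbc.symm]
  rfl

/-- A homomorphism that shifts degrees by an injective map `σ` commutes with the projections. The
projections `p` of the target need not come from a direct sum decomposition. -/
theorem map_internalProj {J : Type*} [DecidableEq J] {N : Type*} [AddCommGroup N]
    (g : M →+ N) (σ : I → J) (hσ : Function.Injective σ) (p : J → N →+ N)
    (hp : ∀ b, ∀ x ∈ 𝓜 b, p (σ b) (g x) = g x)
    (hp' : ∀ b c, σ b ≠ c → ∀ x ∈ 𝓜 b, p c (g x) = 0) (b : I) (x : M) :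
    p (σ b) (g x) = g (internalProj h b x) := by
  induction x using internal_induction h with
  | h0 => simp
  | hadd x y hx hy => rw [map_add, map_add, hx, hy, map_add, map_add]
  | hmem c x hx =>
    by_cases hbc : c = b
    · subst hbc
      rw [internalProj_of_mem h hx, hp c x hx]
    · rw [internalProj_of_ne h hbc hx, hp' c (σ b) (fun h => hbc (hσ h)) x hx, map_zero]

end Internal

section PolyPart

variable {k : Type u} [Field k] {n : ℕ}

/-- The exponent vector of a monomial, as an element of `ℤ^n`. -/
def expZ (m : Fin n →₀ ℕ) : Fin n → ℤ := fun j => m j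

theorem expZ_add (m m' : Fin n →₀ ℕ) : expZ (m + m') = expZ m + expZ m' := by
  ext j; simp [expZ]

theorem expZ_sub {m m' : Fin n →₀ ℕ} (h : m' ≤ m) : expZ (m - m') = expZ m - expZ m' := by
  rw [eq_sub_iff_add_eq, ← expZ_add, tsub_add_cancel_of_le h]

theorem expZ_zero : expZ (0 : Fin n →₀ ℕ) = 0 := rfl

theorem expZ_injective : Function.Injective (expZ (n := n)) := fun m m' h => by
  ext j
  have := congrFun h j
  simpa [expZ] using this

theorem weight_single_eq (m : Fin n →₀ ℕ) :
    Finsupp.weight (fun j : Fin n => (Pi.single j 1 : Fin n → ℤ)) m = expZ m := by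
  rw [Finsupp.weight_apply, Finsupp.sum_fintype _ _ (by simp)]
  ext j
  simp [expZ, Finset.sum_apply, Pi.single_apply]

theorem mem_polyPart_iff {a : Fin n → ℤ} {p : MvPolynomial (Fin n) k} :
    p ∈ polyPart k n a ↔ ∀ m, MvPolynomial.coeff m p ≠ 0 → expZ m = a := by
  rw [MvPolynomial.mem_weightedHomogeneousSubmodule]
  simp only [← weight_single_eq]
  exact ⟨fun h m hm => h hm, fun h m hm => h m hm⟩

theorem monomial_mem_polyPart (m : Fin n →₀ ℕ) (r : k) {a : Fin n → ℤ} (h : expZ m = a) :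
    MvPolynomial.monomial m r ∈ polyPart k n a := by
  rw [mem_polyPart_iff]
  intro m' hm'
  rw [MvPolynomial.coeff_monomial] at hm'
  rw [← h, show m = m' by by_contra h'; simp [h'] at hm']

/-- The homogeneous component of a polynomial in a degree of `ℤ^n`. -/
def polyComp (a : Fin n → ℤ) : MvPolynomial (Fin n) k →ₗ[k] MvPolynomial (Fin n) k :=
  MvPolynomial.weightedHomogeneousComponent (fun j : Fin n => (Pi.single j 1 : Fin n → ℤ)) a

theorem polyComp_of_mem {a : Fin n → ℤ} {p : MvPolynomial (Fin n) k} (h : p ∈ polyPart k n a) :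
    polyComp a p = p :=
  MvPolynomial.IsWeightedHomogeneous.weightedHomogeneousComponent_same h

theorem polyComp_of_ne {a b : Fin n → ℤ} {p : MvPolynomial (Fin n) k} (h : p ∈ polyPart k n a)
    (hab : a ≠ b) : polyComp b p = 0 :=
  MvPolynomial.IsWeightedHomogeneous.weightedHomogeneousComponent_ne b h hab.symm

theorem coeff_polyComp (a : Fin n → ℤ) (p : MvPolynomial (Fin n) k) (m : Fin n →₀ ℕ) :
    MvPolynomial.coeff m (polyComp a p) = if expZ m = a then MvPolynomial.coeff m p else 0 := by
  rw [polyComp, MvPolynomial.coeff_weightedHomogeneousComponent, weight_single_eq]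

/-- A polynomial belongs to a monomial ideal iff its monomials do. -/
theorem mem_monomialIdeal_iff {K : Ideal (MvPolynomial (Fin n) k)} (hK : IsMonomialIdeal K)
    {p : MvPolynomial (Fin n) k} :
    p ∈ K ↔ ∀ m, MvPolynomial.coeff m p ≠ 0 → MvPolynomial.monomial m (1 : k) ∈ K := by
  obtain ⟨A, rfl⟩ := hK
  simp only [MvPolynomial.mem_ideal_span_monomial_image, MvPolynomial.mem_support_iff,
    MvPolynomial.coeff_monomial]
  simp

theorem polyComp_mem {K : Ideal (MvPolynomial (Fin n) k)} (hK : IsMonomialIdeal K)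
    (a : Fin n → ℤ) {p : MvPolynomial (Fin n) k} (hp : p ∈ K) : polyComp a p ∈ K := by
  rw [mem_monomialIdeal_iff hK] at hp ⊢
  intro m hm
  rw [coeff_polyComp] at hm
  exact hp m fun h => hm (by simp [h])

/-- The projection of `S/K` onto its part of degree `a`, for a monomial ideal `K`. -/
def quotComp {K : Ideal (MvPolynomial (Fin n) k)} (hK : IsMonomialIdeal K) (a : Fin n → ℤ) :
    (MvPolynomial (Fin n) k ⧸ K) →+ (MvPolynomial (Fin n) k ⧸ K) :=
  QuotientAddGroup.map _ _ (polyComp (k := k) a).toAddMonoidHom fun _ hp => polyComp_mem hK a hp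

theorem quotComp_of_mem {K : Ideal (MvPolynomial (Fin n) k)} (hK : IsMonomialIdeal K)
    {a : Fin n → ℤ} {y : MvPolynomial (Fin n) k ⧸ K} (hy : y ∈ quotPart K a) :
    quotComp hK a y = y := by
  obtain ⟨p, hp, rfl⟩ := hy
  change K.mkQ (polyComp a p) = K.mkQ p
  rw [polyComp_of_mem hp]

theorem quotComp_of_ne {K : Ideal (MvPolynomial (Fin n) k)} (hK : IsMonomialIdeal K)
    {a b : Fin n → ℤ} (hab : a ≠ b) {y : MvPolynomial (Fin n) k ⧸ K} (hy : y ∈ quotPart K a) :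
    quotComp hK b y = 0 := by
  obtain ⟨p, hp, rfl⟩ := hy
  change K.mkQ (polyComp b p) = 0
  rw [polyComp_of_ne hp hab, map_zero]

end PolyPart

section Multigrading

variable {k : Type u} [Field k] {n : ℕ}

theorem IsMultigrading.smul_mem {M : Type u} [AddCommGroup M]
    [Module (MvPolynomial (Fin n) k) M] {𝓜 : (Fin n → ℤ) → AddSubgroup M}
    (h : IsMultigrading (k := k) 𝓜)
    {p : MvPolynomial (Fin n) k} {a b c : Fin n → ℤ} (hp : p ∈ polyPart k n a) {x : M}
    (hx : x ∈ 𝓜 b) (hc : a + b = c) : p • x ∈ 𝓜 c := by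
  subst hc
  exact h.gradedSMul.smul_mem hp hx

theorem IsMultigrading.internalProj_smul {M : Type u} [AddCommGroup M]
    [Module (MvPolynomial (Fin n) k) M] {𝓜 : (Fin n → ℤ) → AddSubgroup M}
    (h : IsMultigrading (k := k) 𝓜)
    {p : MvPolynomial (Fin n) k} {a b c : Fin n → ℤ} (hp : p ∈ polyPart k n a) (x : M)
    (hc : a + b = c) : internalProj h.isInternal c (p • x) = p • internalProj h.isInternal b x := by
  subst hc
  exact map_internalProj h.isInternal (DistribSMul.toAddMonoidHom M p) (a + ·)
    (add_right_injective a) (internalProj h.isInternal)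
    (fun b x hx => internalProj_of_mem _ (h.smul_mem hp hx rfl))
    (fun b c hbc x hx => internalProj_of_ne _ hbc (h.smul_mem hp hx rfl)) b x

end Multigrading

section TaylorGrading

variable {k : Type u} [Field k] {n : ℕ} {ι : Type} (β : ι → Fin n →₀ ℕ)

/-- The multigrading of the Taylor complex: the basis element indexed by `F` has degree
`lcm (x^(β v) : v ∈ F)`. -/
def taylorPart (i : ℕ) (b : Fin n → ℤ) : AddSubgroup (TaylorX k n ι i) where
  carrier := {x | ∀ F, x F ∈ polyPart k n (b - expZ (F.1.sup β))}
  zero_mem' _ := Submodule.zero_mem _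
  add_mem' hx hy F := Submodule.add_mem _ (hx F) (hy F)
  neg_mem' hx F := Submodule.neg_mem _ (hx F)

theorem single_mem_taylorPart {i : ℕ} {b : Fin n → ℤ} (F : {F : Finset ι // F.card = i})
    {p : MvPolynomial (Fin n) k} (hp : p ∈ polyPart k n (b - expZ (F.1.sup β))) :
    Finsupp.single F p ∈ taylorPart β i b := by
  classical
  intro G
  rw [Finsupp.single_apply]
  split_ifs with h
  · exact h ▸ hp
  · exact Submodule.zero_mem _

theorem taylorPart_induction {i : ℕ} {b : Fin n → ℤ} {q : TaylorX k n ι i → Prop} (h0 : q 0)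
    (hadd : ∀ x y, q x → q y → q (x + y))
    (hsingle : ∀ F p, p ∈ polyPart k n (b - expZ (F.1.sup β)) → q (Finsupp.single F p))
    {x : TaylorX k n ι i} (hx : x ∈ taylorPart β i b) : q x := by
  rw [← Finsupp.sum_single x]
  exact Finset.sum_induction _ q hadd h0 fun F _ => hsingle F _ (hx F)

theorem one_mem_polyPart : (1 : MvPolynomial (Fin n) k) ∈ polyPart k n 0 :=
  monomial_mem_polyPart 0 1 expZ_zero

theorem basis_mem_taylorPart {i : ℕ} (F : {F : Finset ι // F.card = i}) :
    Finsupp.single F (1 : MvPolynomial (Fin n) k) ∈ taylorPart β i (expZ (F.1.sup β)) :=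
  single_mem_taylorPart β F (by rw [sub_self]; exact one_mem_polyPart)

/-- A linear map on a term of the Taylor complex is homogeneous if it is on the basis. -/
theorem map_mem_of_basis {i : ℕ} {N : Type u} [AddCommGroup N] [Module (MvPolynomial (Fin n) k) N]
    {𝓝 : (Fin n → ℤ) → AddSubgroup N} (h𝓝 : SetLike.GradedSMul (polyPart k n) 𝓝)
    (f : TaylorX k n ι i →ₗ[MvPolynomial (Fin n) k] N) (c : Fin n → ℤ)
    (hf : ∀ F, f (Finsupp.single F 1) ∈ 𝓝 (expZ (F.1.sup β) + c)) {b : Fin n → ℤ}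
    {x : TaylorX k n ι i} (hx : x ∈ taylorPart β i b) : f x ∈ 𝓝 (b + c) := by
  refine taylorPart_induction β (q := fun x => f x ∈ 𝓝 (b + c)) ?_ ?_ ?_ hx
  · rw [map_zero]; exact zero_mem _
  · intro x y hx hy
    rw [map_add]; exact add_mem hx hy
  · intro F p hp
    have h1 : Finsupp.single F p = p • Finsupp.single F 1 := by
      rw [Finsupp.smul_single, smul_eq_mul, mul_one]
    have h2 := h𝓝.smul_mem hp (hf F)
    rwa [vadd_eq_add, ← add_assoc, sub_add_cancel, ← map_smul, ← h1] at h2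

theorem taylorPart_gradedSMul (i : ℕ) :
    SetLike.GradedSMul (polyPart k n) (taylorPart (k := k) β i) where
  smul_mem := by
    intro a b p x hp hx F
    have h1 := MvPolynomial.IsWeightedHomogeneous.mul hp (hx F)
    rwa [← add_sub_assoc] at h1

theorem taylorPart_isMultigrading (i : ℕ) : IsMultigrading (k := k) (taylorPart (k := k) β i) where
  gradedSMul := taylorPart_gradedSMul β i
  isInternal := by
    let p : (Fin n → ℤ) → TaylorX k n ι i →ₗ[k] TaylorX k n ι i := fun b =>
      Finsupp.lsum k fun F => Finsupp.lsingle F ∘ₗ polyComp (b - expZ (F.1.sup β))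
    have hp : ∀ b F q, p b (Finsupp.single F q) =
        Finsupp.single F (polyComp (b - expZ (F.1.sup β)) q) := fun b F q =>
      Finsupp.lsum_single _ _ _ _
    refine isInternal_of_projections (fun b => (p b).toAddMonoidHom) ?_ ?_ ?_
    · intro b x hx
      refine taylorPart_induction β (q := fun x => p b x = x) (map_zero _) ?_ ?_ hx
      · intro x y hx hy; rw [map_add, hx, hy]
      · intro F q hq; rw [hp, polyComp_of_mem hq]
    · intro b c hbc x hx
      refine taylorPart_induction β (q := fun x => p c x = 0) (map_zero _) ?_ ?_ hx
      · intro x y hx hy; rw [map_add, hx, hy, add_zero]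
      · intro F q hq
        rw [hp, polyComp_of_ne hq (fun h => hbc (sub_left_injective h)), Finsupp.single_zero]
    · intro x _
      induction x using Finsupp.induction_linear with
      | zero => exact zero_mem _
      | add x y hx hy => exact add_mem (hx trivial) (hy trivial)
      | single F q =>
        induction q using MvPolynomial.induction_on' with
        | monomial m r =>
          refine (le_iSup (taylorPart β i) (expZ m + expZ (F.1.sup β))) ?_
          exact single_mem_taylorPart β F (monomial_mem_polyPart m r (by rw [add_sub_cancel_right]))
        | add p q hp hq => rw [Finsupp.single_add]; exact add_mem (hp trivial) (hq trivial)

theorem quotPart_gradedSMul (K : Ideal (MvPolynomial (Fin n) k)) :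
    SetLike.GradedSMul (polyPart k n) (quotPart K) where
  smul_mem := by
    rintro a b p _ hp ⟨q, hq, rfl⟩
    exact ⟨p * q, MvPolynomial.IsWeightedHomogeneous.mul hp hq, rfl⟩

theorem taylorAug_single (F : {F : Finset ι // F.card = 0}) (p : MvPolynomial (Fin n) k) :
    taylorAug β (Finsupp.single F p) = (monomialSpan k β).mkQ p :=
  Finsupp.lsum_single _ _ _ _

variable [LinearOrder ι]

theorem taylorDiff_mem (i j : ℕ) {b : Fin n → ℤ} {x : TaylorX k n ι i}
    (hx : x ∈ taylorPart β i b) : taylorDiff β i j x ∈ taylorPart β j b := by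
  by_cases h : j + 1 = i
  · subst h
    rw [← add_zero b]
    refine map_mem_of_basis β (taylorPart_gradedSMul β j) _ 0 (fun F => ?_) hx
    have h1 : (1 : MvPolynomial (Fin n) k) = MvPolynomial.monomial 0 1 := rfl
    rw [h1, taylorDiff_single, add_zero]
    refine sum_mem fun v _ => single_mem_taylorPart β _ (monomial_mem_polyPart _ _ ?_)
    rw [zero_add, expZ_sub (sup_erase_le β F.1 v)]
  · rw [taylorDiff_of_ne β h]
    exact zero_mem _

variable [WellFoundedLT ι]

theorem taylorResolution_isGraded : IsGradedResolution (taylorResolution (k := k) β)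
    (taylorPart β) where
  multigrading := taylorPart_isMultigrading β
  d_mem i j _ _ hp := taylorDiff_mem β i j hp
  π_mem b p hp := by
    rw [taylorResolution_π]
    have h1 : taylorAug β p ∈ quotPart (monomialSpan k β) (b + 0) := by
      refine map_mem_of_basis β (quotPart_gradedSMul _) (taylorAug β) 0 (fun F => ?_) hp
      obtain ⟨F, hF⟩ := F
      obtain rfl := Finset.card_eq_zero.1 hF
      exact ⟨1, one_mem_polyPart, (taylorAug_single β _ _).symm⟩
    rw [add_zero] at h1
    exact h1

/-- The map from the Taylor resolution to a multigraded resolution that lifts a quotient map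
can be chosen to preserve degrees. -/
theorem exists_graded_lift {K : Ideal (MvPolynomial (Fin n) k)} (hKmon : IsMonomialIdeal K)
    (hK : monomialSpan k β ≤ K)
    (Q : ProjectiveResolution (ModuleCat.of (MvPolynomial (Fin n) k) (MvPolynomial (Fin n) k ⧸ K)))
    (𝓠 : (i : ℕ) → (Fin n → ℤ) → AddSubgroup (Q.complex.X i)) (hQ : IsGradedResolution Q 𝓠) :
    ∃ φ : (taylorResolution β).complex ⟶ Q.complex,
      φ.f 0 ≫ Q.π.f 0 = (taylorResolution β).π.f 0 ≫ quotMap hK ∧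
      ∀ i b x, x ∈ taylorPart β i b → (φ.f i).hom x ∈ 𝓠 i b := by
  let ψ := ProjectiveResolution.lift (quotMap hK) (taylorResolution β) Q
  have hψ0 : ψ.f 0 ≫ Q.π.f 0 = (taylorResolution β).π.f 0 ≫ quotMap hK :=
    ProjectiveResolution.lift_commutes_zero _ _ _
  let ψl : ∀ i, TaylorX k n ι i →ₗ[MvPolynomial (Fin n) k] Q.complex.X i := fun i => (ψ.f i).hom
  have hψd : ∀ i j x, (Q.complex.d i j).hom (ψl i x) = ψl j (taylorDiff β i j x) := fun i j x =>
    congrArg (fun f => f.hom x) (ψ.comm i j)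
  have hI : ∀ i, DirectSum.IsInternal (𝓠 i) := fun i => (hQ.multigrading i).isInternal
  -- The component of degree `0` of the lift `ψ`: on each basis element, keep only the part of the
  -- value that has the degree of the basis element.
  let φl : ∀ i, TaylorX k n ι i →ₗ[MvPolynomial (Fin n) k] Q.complex.X i := fun i =>
    Finsupp.lsum (MvPolynomial (Fin n) k) fun F => LinearMap.toSpanSingleton _ _
      (internalProj (hI i) (expZ (F.1.sup β)) (ψl i (Finsupp.single F 1)))
  have hφ : ∀ i b x, x ∈ taylorPart β i b → φl i x = internalProj (hI i) b (ψl i x) := by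
    intro i b x hx
    refine taylorPart_induction β (q := fun x => φl i x = internalProj (hI i) b (ψl i x))
      ?_ ?_ ?_ hx
    · simp only [map_zero]
    · intro x y hx hy
      simp only [map_add, hx, hy]
    · intro F p hp
      have h1 : Finsupp.single F p = p • Finsupp.single F 1 := by
        rw [Finsupp.smul_single, smul_eq_mul, mul_one]
      have h2 : φl i (Finsupp.single F p) = p • internalProj (hI i) (expZ (F.1.sup β))
          (ψl i (Finsupp.single F 1)) := Finsupp.lsum_single _ _ _ _
      rw [h2, h1, map_smul, (hQ.multigrading i).internalProj_smul hp _ (sub_add_cancel _ _)]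
  have hd : ∀ i j b x, internalProj (hI j) b ((Q.complex.d i j).hom x) =
      (Q.complex.d i j).hom (internalProj (hI i) b x) := fun i j b x =>
    map_internalProj (hI i) ((Q.complex.d i j).hom.toAddMonoidHom) id Function.injective_id
      (internalProj (hI j)) (fun b x hx => internalProj_of_mem _ (hQ.d_mem i j b x hx))
      (fun b c hbc x hx => internalProj_of_ne _ hbc (hQ.d_mem i j b x hx)) b x
  have hφd : ∀ i j x, (Q.complex.d i j).hom (φl i x) = φl j (taylorDiff β i j x) := by
    intro i j x
    suffices h : (Q.complex.d i j).hom ∘ₗ φl i = φl j ∘ₗ taylorDiff β i j from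
      LinearMap.congr_fun h x
    refine Finsupp.lhom_ext' fun F => LinearMap.ext_ring ?_
    simp only [LinearMap.comp_apply, Finsupp.lsingle_apply]
    rw [hφ i _ _ (basis_mem_taylorPart β F), ← hd, hψd,
      hφ j _ _ (taylorDiff_mem β i j (basis_mem_taylorPart β F))]
  refine ⟨{ f := fun i => ModuleCat.ofHom (φl i), comm' := fun i j _ =>
      ModuleCat.hom_ext (LinearMap.ext fun x => hφd i j x) }, ?_, fun i b x hx => ?_⟩
  · refine ModuleCat.hom_ext ?_
    have h0 : (Q.π.f 0).hom ∘ₗ ψl 0 = (quotMap hK).hom ∘ₗ taylorAug β := by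
      refine (congrArg ModuleCat.Hom.hom hψ0).trans ?_
      rw [taylorResolution_π]
      rfl
    have h3 : (Q.π.f 0).hom ∘ₗ φl 0 = (quotMap hK).hom ∘ₗ taylorAug β := by
      rw [← h0]
      refine Finsupp.lhom_ext' fun F => LinearMap.ext_ring ?_
      obtain ⟨F, hF⟩ := F
      obtain rfl := Finset.card_eq_zero.1 hF
      simp only [LinearMap.comp_apply, Finsupp.lsingle_apply]
      rw [hφ 0 _ _ (basis_mem_taylorPart β _)]
      have hπ : ∀ b x, quotComp hKmon b ((Q.π.f 0).hom x) =
          (Q.π.f 0).hom (internalProj (hI 0) b x) := fun b x =>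
        map_internalProj (hI 0) ((Q.π.f 0).hom.toAddMonoidHom) id Function.injective_id
          (quotComp hKmon) (fun b x hx => quotComp_of_mem hKmon (hQ.π_mem b x hx))
          (fun b c hbc x hx => quotComp_of_ne hKmon hbc (hQ.π_mem b x hx)) b x
      refine (hπ _ _).symm.trans (quotComp_of_mem hKmon ?_)
      have h4 := LinearMap.congr_fun h0 (Finsupp.single ⟨∅, hF⟩ 1)
      refine ⟨1, ?_, Eq.trans ?_ h4.symm⟩
      · exact one_mem_polyPart
      · exact (congrArg (quotMap hK).hom (taylorAug_single β ⟨∅, hF⟩ 1)).symm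
    refine h3.trans ?_
    rw [taylorResolution_π]
    rfl
  · exact (hφ i b x hx).symm ▸ internalProj_mem (hI i) b _

end TaylorGrading

/-! ### Koszul resolutions and homogeneous classes -/

section Comparison

variable {k : Type u} [Field k] {n : ℕ} {ι : Type}

theorem monomialSpan_anti {β β' : ι → Fin n →₀ ℕ} (h : β' ≤ β) :
    monomialSpan k β ≤ monomialSpan k β' := by
  refine Ideal.span_le.2 ?_
  rintro _ ⟨v, rfl⟩
  refine Ideal.mem_of_dvd _ ?_ (Ideal.subset_span ⟨v, rfl⟩)
  exact MvPolynomial.monomial_dvd_monomial.2 ⟨Or.inr (h v), dvd_rfl⟩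

/-- The comparison map between the Taylor complexes of two families of monomials, where `x^(β' v)`
divides `x^(β v)` for all `v`: on the basis it multiplies by the quotient of the least common
multiples. -/
def taylorMap (β β' : ι → Fin n →₀ ℕ) (i : ℕ) :
    TaylorX k n ι i →ₗ[MvPolynomial (Fin n) k] TaylorX k n ι i :=
  Finsupp.lsum (MvPolynomial (Fin n) k) fun F => LinearMap.toSpanSingleton _ _
    (Finsupp.single F (MvPolynomial.monomial (F.1.sup β - F.1.sup β') 1))

theorem taylorMap_single (β β' : ι → Fin n →₀ ℕ) {i : ℕ} (F : {F : Finset ι // F.card = i})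
    (p : MvPolynomial (Fin n) k) :
    taylorMap β β' i (Finsupp.single F p) =
      Finsupp.single F (p * MvPolynomial.monomial (F.1.sup β - F.1.sup β') 1) := by
  rw [taylorMap, Finsupp.lsum_single, LinearMap.toSpanSingleton_apply, Finsupp.smul_single,
    smul_eq_mul]

theorem sup_le_sup_of_le {β β' : ι → Fin n →₀ ℕ} (h : β' ≤ β) (F : Finset ι) :
    F.sup β' ≤ F.sup β :=
  Finset.sup_mono_fun fun v _ => h v

variable [LinearOrder ι]

theorem taylorDiff_taylorMap {β β' : ι → Fin n →₀ ℕ} (h : β' ≤ β) (i j : ℕ)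
    (x : TaylorX k n ι i) :
    taylorDiff β' i j (taylorMap β β' i x) = taylorMap β β' j (taylorDiff β i j x) := by
  by_cases hij : j + 1 = i
  · subst hij
    suffices h : taylorDiff β' (j + 1) j ∘ₗ taylorMap β β' (j + 1) =
      taylorMap (k := k) β β' j ∘ₗ taylorDiff β (j + 1) j from LinearMap.congr_fun h x
    refine Finsupp.lhom_ext' fun F => LinearMap.ext_ring ?_
    simp only [LinearMap.comp_apply, Finsupp.lsingle_apply]
    have h1 : (1 : MvPolynomial (Fin n) k) = MvPolynomial.monomial 0 1 := rfl
    rw [taylorMap_single, one_mul, taylorDiff_single, h1, taylorDiff_single, map_sum]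
    refine Finset.sum_congr rfl fun v _ => ?_
    rw [taylorMap_single, MvPolynomial.monomial_mul, zero_add, mul_one, mul_one,
      tsub_add_cancel_of_le (sup_le_sup_of_le h F.1),
      tsub_add_tsub_cancel (sup_erase_le β F.1 v) (sup_le_sup_of_le h _)]
  · rw [taylorDiff_of_ne β hij, taylorDiff_of_ne β' hij, LinearMap.zero_apply,
      LinearMap.zero_apply, map_zero]

variable [WellFoundedLT ι]

/-- The comparison map as a map of complexes. -/
def taylorResolutionMap {β β' : ι → Fin n →₀ ℕ} (h : β' ≤ β) :
    (taylorResolution (k := k) β).complex ⟶ (taylorResolution (k := k) β').complex where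
  f i := ModuleCat.ofHom (taylorMap β β' i)
  comm' i j _ := ModuleCat.hom_ext (LinearMap.ext (taylorDiff_taylorMap h i j))

theorem taylorResolutionMap_comm {β β' : ι → Fin n →₀ ℕ} (h : β' ≤ β) :
    (taylorResolutionMap (k := k) h).f 0 ≫ (taylorResolution β').π.f 0 =
      (taylorResolution β).π.f 0 ≫ quotMap (monomialSpan_anti h) := by
  rw [taylorResolution_π, taylorResolution_π]
  refine ModuleCat.hom_ext (Finsupp.lhom_ext' fun F => LinearMap.ext_ring ?_)
  obtain ⟨F, hF⟩ := F
  obtain rfl := Finset.card_eq_zero.1 hF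
  change taylorAug β' (taylorMap β β' 0 (Finsupp.single ⟨∅, hF⟩ 1)) =
    (quotMap (monomialSpan_anti h)).hom (taylorAug β (Finsupp.single ⟨∅, hF⟩ 1))
  rw [taylorMap_single, taylorAug_single, taylorAug_single, one_mul, Finset.sup_empty,
    Finset.sup_empty, tsub_self]
  rfl

end Comparison

section Ideals

variable {k : Type u} [Field k] {n : ℕ}

/-- A monomial ideal has a multigraded resolution whose maps into multigraded resolutions of larger
monomial quotients can be chosen to preserve degrees. -/
theorem exists_graded_resolution {K : Ideal (MvPolynomial (Fin n) k)} (hK : IsMonomialIdeal K) :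
    ∃ (P : ProjectiveResolution (ModuleCat.of (MvPolynomial (Fin n) k)
        (MvPolynomial (Fin n) k ⧸ K))) (𝓟 : (i : ℕ) → (Fin n → ℤ) → AddSubgroup (P.complex.X i)),
      IsGradedResolution P 𝓟 ∧
      ∀ (K' : Ideal (MvPolynomial (Fin n) k)) (_ : IsMonomialIdeal K') (hKK' : K ≤ K')
        (Q : ProjectiveResolution (ModuleCat.of (MvPolynomial (Fin n) k)
          (MvPolynomial (Fin n) k ⧸ K')))
        (𝓠 : (i : ℕ) → (Fin n → ℤ) → AddSubgroup (Q.complex.X i)) (_ : IsGradedResolution Q 𝓠),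
        ∃ φ : P.complex ⟶ Q.complex, φ.f 0 ≫ Q.π.f 0 = P.π.f 0 ≫ quotMap hKK' ∧
          ∀ i b x, x ∈ 𝓟 i b → (φ.f i).hom x ∈ 𝓠 i b := by
  obtain ⟨A, hA⟩ := hK
  -- The homotopy of the Taylor complex needs a well-ordering of the generators.
  obtain ⟨_, _⟩ := exists_wellFoundedLT A
  have hβ : K = monomialSpan k (fun b : A => b.1) := by
    rw [hA, monomialSpan, Set.image_eq_range]
  clear hA
  subst hβ
  exact ⟨taylorResolution _, taylorPart _, taylorResolution_isGraded _,
    fun K' hK' hKK' Q 𝓠 hQ => exists_graded_lift _ hK' hKK' Q 𝓠 hQ⟩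

theorem isMonomialIdeal_pow (t : ℕ) :
    IsMonomialIdeal (MvPolynomial.idealOfVars (Fin n) k ^ t) :=
  ⟨_, MvPolynomial.pow_idealOfVars_eq_span t⟩

theorem isMonomialIdeal_monomialSpan {ι : Type} (β : ι → Fin n →₀ ℕ) :
    IsMonomialIdeal (monomialSpan k β) :=
  ⟨Set.range β, by rw [monomialSpan, ← Set.range_comp]; rfl⟩

/-- The exponents of `x_1^s, …, x_n^s`. -/
def powExp (n s : ℕ) (v : Fin n) : Fin n →₀ ℕ := Finsupp.single v s

theorem powExp_mono {s t : ℕ} (h : t ≤ s) : powExp n t ≤ powExp n s := fun _ =>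
  Finsupp.single_mono h

theorem sup_powExp_apply (s : ℕ) (F : Finset (Fin n)) (j : Fin n) :
    F.sup (powExp n s) j = if j ∈ F then s else 0 := by
  induction F using Finset.induction_on with
  | empty => simp [bot_eq_zero]
  | insert v F hv ih =>
    rw [Finset.sup_insert, Finsupp.sup_apply, ih, powExp, Finsupp.single_apply]
    by_cases h : v = j
    · subst h; simp [hv]
    · have : j ≠ v := fun h' => h h'.symm
      simp [h, this]

theorem monomialSpan_powExp_le {s t : ℕ} (h : t ≤ s) :
    monomialSpan k (powExp n s) ≤ MvPolynomial.idealOfVars (Fin n) k ^ t := by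
  refine Ideal.span_le.2 ?_
  rintro _ ⟨v, rfl⟩
  change MvPolynomial.monomial (Finsupp.single v s) (1 : k) ∈ _
  rw [← MvPolynomial.X_pow_eq_monomial]
  exact Ideal.pow_le_pow_right h (Ideal.pow_mem_pow (Ideal.subset_span (Set.mem_range_self v)) s)

/-- By the pigeonhole principle, some exponent of a monomial of degree `n s + 1` is at least `s`. -/
theorem pow_le_monomialSpan_powExp (s : ℕ) :
    MvPolynomial.idealOfVars (Fin n) k ^ (n * s + 1) ≤ monomialSpan k (powExp n s) := by
  rw [MvPolynomial.pow_idealOfVars_eq_span]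
  refine Ideal.span_le.2 ?_
  rintro _ ⟨m, hm, rfl⟩
  have hm' : m.degree = n * s + 1 := hm
  obtain ⟨v, hv⟩ : ∃ v, s ≤ m v := by
    by_contra! hc
    have h1 : m.degree ≤ ∑ _v : Fin n, s := by
      rw [Finsupp.degree_eq_sum]
      exact Finset.sum_le_sum fun v _ => (hc v).le
    simp at h1
    omega
  refine Ideal.mem_of_dvd _ ?_ (Ideal.subset_span ⟨v, rfl⟩)
  exact MvPolynomial.monomial_dvd_monomial.2 ⟨Or.inr (Finsupp.single_le_iff.2 hv), dvd_rfl⟩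

variable {M : ModuleCat.{u} (MvPolynomial (Fin n) k)} {𝓜 : (Fin n → ℤ) → AddSubgroup M} {i : ℕ}

variable (k n) in
/-- The Koszul resolution of `S/(x_1^s, …, x_n^s)`, which is the Taylor resolution of these
monomials as they are pairwise coprime. -/
abbrev koszul (s : ℕ) := taylorResolution (k := k) (powExp n s)

/-- Homogeneous cocycles on a Koszul resolution have homogeneous classes: they are pulled back along
a degree-preserving lift to a multigraded resolution of a quotient by a power of `𝔪`. -/
theorem isHomogeneousClass_of_koszul (h𝓜 : SetLike.GradedSMul (polyPart k n) 𝓜)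
    {s : ℕ} {a : Fin n → ℤ}
    (f : TaylorX k n (Fin n) i →ₗ[MvPolynomial (Fin n) k] M)
    (hf : ∀ F, f (Finsupp.single F 1) ∈ 𝓜 (expZ (F.1.sup (powExp n s)) + a))
    {h : (localCohomology (MvPolynomial.idealOfVars (Fin n) k) i).obj M}
    (hh : IsLocalClass (koszul k n s) (ModuleCat.ofHom f) h) : IsHomogeneousClass M 𝓜 i a h := by
  obtain ⟨P, 𝓟, hP, hlift⟩ := exists_graded_resolution
    (isMonomialIdeal_pow (k := k) (n := n) (n * s + 1))
  obtain ⟨φ, hφ, hφ'⟩ := hlift _ (isMonomialIdeal_monomialSpan (powExp n s))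
    (pow_le_monomialSpan_powExp s) (koszul k n s) _ (taylorResolution_isGraded _)
  obtain ⟨e, he, he'⟩ := (hh.map (pow_le_monomialSpan_powExp s) hφ le_rfl).exists_of_le le_rfl
  refine ⟨n * s + 1, P, 𝓟, _, e, hP, fun b p hp => ?_, he, ?_⟩
  · exact map_mem_of_basis (powExp n s) h𝓜 f a hf (hφ' i b p hp)
  · rw [← he']
    exact (extToLocalCohomology_extQuotMap _ i le_rfl M e).symm

/-- A homogeneous class is represented by homogeneous cocycles on the Koszul resolutions for all
large exponents. -/
theorem IsHomogeneousClass.exists_koszul {a : Fin n → ℤ}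
    {h : (localCohomology (MvPolynomial.idealOfVars (Fin n) k) i).obj M}
    (hh : IsHomogeneousClass M 𝓜 i a h) :
    ∃ t : ℕ, ∀ s, t ≤ s → ∃ f : TaylorX k n (Fin n) i →ₗ[MvPolynomial (Fin n) k] M,
      (∀ F, f (Finsupp.single F 1) ∈ 𝓜 (expZ (F.1.sup (powExp n s)) + a)) ∧
      IsLocalClass (koszul k n s) (ModuleCat.ofHom f) h := by
  obtain ⟨t, P, 𝓟, f, e, hP, hf, he, rfl⟩ := hh
  refine ⟨t, fun s hs => ?_⟩
  obtain ⟨φ, hφ, hφ'⟩ := exists_graded_lift (powExp n s) (isMonomialIdeal_pow (k := k) t)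
    (monomialSpan_powExp_le hs) P 𝓟 hP
  refine ⟨(φ.f i ≫ f).hom, fun F => hf _ _ (hφ' i _ _ (basis_mem_taylorPart _ F)), ?_⟩
  have h1 : IsLocalClass P f ((extToLocalCohomology (MvPolynomial.idealOfVars (Fin n) k) i t M).hom
      e) := ⟨t, le_rfl, e, he, extToLocalCohomology_extQuotMap _ i le_rfl M e⟩
  exact h1.map _ hφ (pow_le_monomialSpan_powExp s)

end Ideals

/-! ### Relative cochains, coefficients and degree complexes -/

section Cochains

variable {k : Type u} [Field k] {n : ℕ} {Φ : RelComplex n}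

/-- The value of a relative cochain on a face. -/
def cochainVal {t : ℤ} (l : RelChain Φ t →ₗ[ℤ] k) (F : Face Φ.Δ t) : k :=
  l ((subChain Φ t).mkQ (Finsupp.single F 1))

theorem cochain_ext {t : ℤ} {l l' : RelChain Φ t →ₗ[ℤ] k}
    (h : ∀ F, cochainVal l F = cochainVal l' F) : l = l' := by
  refine Submodule.linearMap_qext _ (Finsupp.lhom_ext' fun F => LinearMap.ext_ring ?_)
  exact h F

theorem cochainVal_of_mem {t : ℤ} (l : RelChain Φ t →ₗ[ℤ] k) {F : Face Φ.Δ t} (hF : F.1 ∈ Φ.Γ) :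
    cochainVal l F = 0 := by
  have h : (subChain Φ t).mkQ (Finsupp.single F 1) = 0 := by
    rw [Submodule.mkQ_apply, Submodule.Quotient.mk_eq_zero]
    exact Submodule.subset_span ⟨F, hF, rfl⟩
  rw [cochainVal, h, map_zero]

theorem cochainVal_coboundary {s t : ℤ} (h : s = t + 1) (l : RelChain Φ t →ₗ[ℤ] k)
    (F : Face Φ.Δ s) : cochainVal (coboundary k Φ h l) F =
      ∑ v : {v // v ∈ F.1}, (-1 : k) ^ pos F.1 v.1 * cochainVal l (F.erase h v) := by
  have h1 : cochainVal (coboundary k Φ h l) F =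
      l ((subChain Φ t).mkQ (boundary Φ.Δ h (Finsupp.single F 1))) := rfl
  rw [h1, boundary, Finsupp.lsum_single, LinearMap.toSpanSingleton_apply, one_smul, map_sum,
    map_sum]
  refine Finset.sum_congr rfl fun v _ => ?_
  have h2 : Finsupp.single (F.erase h v) ((-1 : ℤ) ^ position F.1 v.1) =
      ((-1 : ℤ) ^ position F.1 v.1) • Finsupp.single (F.erase h v) (1 : ℤ) := by
    rw [Finsupp.smul_single, smul_eq_mul, mul_one]
  rw [h2, map_smul, map_smul, zsmul_eq_mul]
  push_cast
  rfl

/-- The relative cochain with prescribed values on the faces, which have to vanish on the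
subcomplex. -/
def cochainOf (t : ℤ) (c : Finset (Fin n) → k) (hc : ∀ F ∈ Φ.Γ, c F = 0) :
    RelChain Φ t →ₗ[ℤ] k :=
  (subChain Φ t).liftQ
    (Finsupp.lsum ℤ fun F : Face Φ.Δ t => LinearMap.toSpanSingleton ℤ k (c F.1)) <| by
      refine Submodule.span_le.2 ?_
      rintro _ ⟨F, hF, rfl⟩
      rw [SetLike.mem_coe, LinearMap.mem_ker, Finsupp.lsum_single,
        LinearMap.toSpanSingleton_apply, hc _ hF, smul_zero]

theorem cochainVal_cochainOf {t : ℤ} (c : Finset (Fin n) → k) (hc : ∀ F ∈ Φ.Γ, c F = 0)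
    (F : Face Φ.Δ t) : cochainVal (cochainOf t c hc) F = c F.1 := by
  have h : cochainVal (cochainOf t c hc) F = Finsupp.lsum ℤ
      (fun F : Face Φ.Δ t => LinearMap.toSpanSingleton ℤ k (c F.1)) (Finsupp.single F 1) := rfl
  rw [h, Finsupp.lsum_single, LinearMap.toSpanSingleton_apply, one_smul]

theorem subsingleton_relCohomology {t : ℤ} (h : IsEmpty (Face Φ.Δ t)) :
    Subsingleton (RelCohomology k Φ t) := by
  have h1 : Subsingleton (RelChain Φ t →ₗ[ℤ] k) := ⟨fun l l' => cochain_ext fun F => h.elim F⟩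
  infer_instance

end Cochains

section Coefficients

variable {k : Type u} [Field k] {n : ℕ} {I J : Ideal (MvPolynomial (Fin n) k)}

theorem idealQuotPart_gradedSMul : SetLike.GradedSMul (polyPart k n) (idealQuotPart I J) where
  smul_mem := by
    rintro a b p _ hp ⟨q, hq, rfl⟩
    exact ⟨p • q, MvPolynomial.IsWeightedHomogeneous.mul hp hq, rfl⟩

open Classical in
/-- The coefficient of `x^m`, as a functional on `I/J`, if `x^m` does not belong to the monomial
ideal `J`, and zero otherwise. -/
def quotCoeff (I : Ideal (MvPolynomial (Fin n) k)) {J : Ideal (MvPolynomial (Fin n) k)}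
    (hJ : IsMonomialIdeal J) (m : Fin n →₀ ℕ) : IdealQuot I J →+ k :=
  if hm : MvPolynomial.monomial m (1 : k) ∈ J then 0 else
    QuotientAddGroup.lift (J.submoduleOf I).toAddSubgroup
      ((MvPolynomial.lcoeff k m).toAddMonoidHom.comp I.subtype.toAddMonoidHom) fun p hp => by
        by_contra h
        exact hm ((mem_monomialIdeal_iff hJ).1 (show (p : MvPolynomial (Fin n) k) ∈ J from hp) m h)

variable (hJ : IsMonomialIdeal J)

theorem quotCoeff_mk {m : Fin n →₀ ℕ} (hm : MvPolynomial.monomial m (1 : k) ∉ J) (p : I) :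
    quotCoeff I hJ m ((J.submoduleOf I).mkQ p) = MvPolynomial.coeff m p.1 := by
  exact DFunLike.congr_fun (dif_neg hm : quotCoeff I hJ m = _) ((J.submoduleOf I).mkQ p)

theorem monomial_mem_of_le {K : Ideal (MvPolynomial (Fin n) k)} {m m' : Fin n →₀ ℕ} (h : m ≤ m')
    (hm : MvPolynomial.monomial m (1 : k) ∈ K) : MvPolynomial.monomial m' (1 : k) ∈ K :=
  K.mem_of_dvd (MvPolynomial.monomial_dvd_monomial.2 ⟨Or.inr h, dvd_rfl⟩) hm

theorem quotCoeff_monomial_smul {m : Fin n →₀ ℕ} (hm : MvPolynomial.monomial m (1 : k) ∉ J)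
    (m' : Fin n →₀ ℕ) (r : k) (y : IdealQuot I J) :
    quotCoeff I hJ m (MvPolynomial.monomial m' r • y) =
      if m' ≤ m then r * quotCoeff I hJ (m - m') y else 0 := by
  obtain ⟨p, rfl⟩ := (J.submoduleOf I).mkQ_surjective y
  have hm' : MvPolynomial.monomial (m - m') (1 : k) ∉ J := fun h =>
    hm (monomial_mem_of_le tsub_le_self h)
  rw [← map_smul, quotCoeff_mk hJ hm, quotCoeff_mk hJ hm', Submodule.coe_smul, smul_eq_mul,
    MvPolynomial.coeff_monomial_mul']

theorem quotCoeff_of_notMem (hI : IsMonomialIdeal I) {m : Fin n →₀ ℕ}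
    (hm : MvPolynomial.monomial m (1 : k) ∉ I) (y : IdealQuot I J) : quotCoeff I hJ m y = 0 := by
  obtain ⟨p, rfl⟩ := (J.submoduleOf I).mkQ_surjective y
  by_cases hmJ : MvPolynomial.monomial m (1 : k) ∈ J
  · exact DFunLike.congr_fun (dif_pos hmJ : quotCoeff I hJ m = 0) _
  · rw [quotCoeff_mk hJ hmJ]
    by_contra h
    exact hm ((mem_monomialIdeal_iff hI).1 p.2 m h)

/-- A homogeneous element of `I/J` vanishes if its coefficient does. -/
theorem eq_zero_of_quotCoeff {c : Fin n → ℤ} {y : IdealQuot I J} (hy : y ∈ idealQuotPart I J c)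
    (h : ∀ m, expZ m = c → MvPolynomial.monomial m (1 : k) ∉ J → quotCoeff I hJ m y = 0) :
    y = 0 := by
  obtain ⟨p, hp, rfl⟩ := hy
  refine (Submodule.Quotient.mk_eq_zero _).2 (show (p : MvPolynomial (Fin n) k) ∈ J from ?_)
  rw [mem_monomialIdeal_iff hJ]
  intro m hm
  by_contra hmJ
  exact hm ((quotCoeff_mk hJ hmJ p).symm.trans (h m (mem_polyPart_iff.1 hp m hm) hmJ))

end Coefficients

section DegreeComplex

variable {k : Type u} [Field k] {n : ℕ} (a : Fin n → ℤ)

/-- The exponent `a + s ∑_{j ∈ F} e_j`, with negative entries replaced by zero. -/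
def shiftExp (s : ℕ) (F : Finset (Fin n)) : Fin n →₀ ℕ :=
  Finsupp.equivFunOnFinite.symm fun j => (a j + if j ∈ F then (s : ℤ) else 0).toNat

theorem shiftExp_apply (s : ℕ) (F : Finset (Fin n)) (j : Fin n) :
    shiftExp a s F j = (a j + if j ∈ F then (s : ℤ) else 0).toNat := rfl

theorem mem_negSupport {a : Fin n → ℤ} {j : Fin n} : j ∈ negSupport a ↔ a j < 0 := by
  simp [negSupport]

theorem expZ_shiftExp {s : ℕ} (hs : ∀ j, 0 ≤ a j + s) {F : Finset (Fin n)}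
    (hF : negSupport a ⊆ F) : expZ (shiftExp a s F) = expZ (F.sup (powExp n s)) + a := by
  ext j
  simp only [expZ, shiftExp_apply, Pi.add_apply, sup_powExp_apply]
  have := hs j
  by_cases hj : j ∈ F
  · simp only [hj, if_true]; omega
  · have h0 : ¬ a j < 0 := fun h => hj (hF (mem_negSupport.2 h))
    simp only [hj, if_false]; omega

theorem shiftExp_eq_add {s t : ℕ} (ht : ∀ j, 0 ≤ a j + t) (hts : t ≤ s) {F : Finset (Fin n)}
    (hF : negSupport a ⊆ F) :
    shiftExp a s F = shiftExp a t F + (F.sup (powExp n s) - F.sup (powExp n t)) := by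
  apply expZ_injective
  rw [expZ_add, expZ_sub (sup_le_sup_of_le (powExp_mono hts) F), expZ_shiftExp a ht hF,
    expZ_shiftExp a (fun j => (ht j).trans (by gcongr)) hF]
  abel

theorem sup_powExp_sub_erase (s : ℕ) {F : Finset (Fin n)} {v : Fin n} (hv : v ∈ F) :
    F.sup (powExp n s) - (F.erase v).sup (powExp n s) = Finsupp.single v s := by
  ext j
  rw [Finsupp.tsub_apply, sup_powExp_apply, sup_powExp_apply, Finsupp.single_apply]
  by_cases hj : v = j
  · subst hj; simp [hv]
  · simp [hj, Ne.symm hj]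

theorem shiftExp_erase {s : ℕ} {F : Finset (Fin n)} {v : Fin n} (hv : v ∈ F)
    (hvG : v ∉ negSupport a) :
    Finsupp.single v s ≤ shiftExp a s F ∧
      shiftExp a s F - Finsupp.single v s = shiftExp a s (F.erase v) := by
  rw [mem_negSupport] at hvG
  constructor
  · rw [Finsupp.single_le_iff, shiftExp_apply, if_pos hv]; omega
  · ext j
    rw [Finsupp.tsub_apply, shiftExp_apply, shiftExp_apply, Finsupp.single_apply]
    by_cases hj : v = j
    · subst hj; simp [hv]; omega
    · simp [hj, Ne.symm hj]

/-- For `v ∈ G_a` the exponent `a v + s` of `x_v` is less than `s`. -/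
theorem not_single_le_shiftExp {s : ℕ} (hs : 0 < s) {F : Finset (Fin n)} {v : Fin n} (hv : v ∈ F)
    (hvG : v ∈ negSupport a) : ¬ Finsupp.single v s ≤ shiftExp a s F := by
  rw [mem_negSupport] at hvG
  rw [Finsupp.single_le_iff, shiftExp_apply, if_pos hv]
  omega

/-- For large `s`, the monomial `x^(a + s ∑_{j ∈ F} e_j)` belongs to the ideal iff `F \ G_a` is
not a face of its degree complex. Only the exponents outside `F` restrict divisibility by a
generator. -/
theorem exists_shiftExp_mem_iff (K : Ideal (MvPolynomial (Fin n) k)) :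
    ∃ T : ℕ, ∀ s, T ≤ s → ∀ F, negSupport a ⊆ F →
      (MvPolynomial.monomial (shiftExp a s F) (1 : k) ∈ K ↔
        F \ negSupport a ∉ degreeComplex K a) := by
  have h1 : ∀ F : Finset (Fin n), ∃ T : ℕ, ∀ s, T ≤ s → negSupport a ⊆ F →
      F \ negSupport a ∉ degreeComplex K a →
      MvPolynomial.monomial (shiftExp a s F) (1 : k) ∈ K := by
    intro F
    by_cases hF : negSupport a ⊆ F ∧ F \ negSupport a ∉ degreeComplex K a
    · obtain ⟨hGF, hF⟩ := hF
      obtain ⟨b, hb, hba⟩ : ∃ b, IsMinGen K b ∧ ∀ i ∉ F, (b i : ℤ) ≤ a i := by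
        by_contra! hc
        refine hF ⟨Finset.sdiff_inter_self _ _, fun b hb => ?_⟩
        obtain ⟨i, hi, h⟩ := hc b hb
        exact ⟨i, by rwa [Finset.sdiff_union_of_subset hGF], h⟩
      -- This exponent is at least `b j - a j` for every `j`.
      refine ⟨∑ j, b j + ∑ j, (a j).natAbs, fun s hs _ _ => monomial_mem_of_le ?_ hb.1⟩
      intro j
      rw [shiftExp_apply]
      have hbj := Finset.single_le_sum (f := fun j => b j) (fun _ _ => Nat.zero_le _)
        (Finset.mem_univ j)
      have haj := Finset.single_le_sum (f := fun j => (a j).natAbs) (fun _ _ => Nat.zero_le _)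
        (Finset.mem_univ j)
      by_cases hj : j ∈ F
      · rw [if_pos hj]; omega
      · have := hba j hj
        rw [if_neg hj]; omega
    · exact ⟨0, fun s _ h h' => absurd ⟨h, h'⟩ hF⟩
  choose T hT using h1
  refine ⟨Finset.univ.sup T, fun s hs F hGF => ⟨fun hmem hF => ?_, fun hF =>
    hT F s ((Finset.le_sup (Finset.mem_univ F)).trans hs) hGF hF⟩⟩
  obtain ⟨b, hb, hbmin⟩ := exists_minimal_le_of_wellFoundedLT
    (fun c : Fin n →₀ ℕ => MvPolynomial.monomial c (1 : k) ∈ K) _ hmem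
  obtain ⟨i, hi, hai⟩ := hF.2 b hbmin
  rw [Finset.sdiff_union_of_subset hGF] at hi
  have h2 := hb i
  have h3 : ¬ a i < 0 := fun h => hi (hGF (mem_negSupport.2 h))
  rw [shiftExp_apply, if_neg hi] at h2
  omega

/-- The exponent `s` is so large that the Koszul complex on `x_1^s, …, x_n^s` computes the part of
degree `a` of the local cohomology of `I/J`. -/
structure IsLarge (I J : Ideal (MvPolynomial (Fin n) k)) (s : ℕ) : Prop where
  pos : 0 < s
  nonneg : ∀ j, 0 ≤ a j + s
  mem_left : ∀ F, negSupport a ⊆ F → (MvPolynomial.monomial (shiftExp a s F) (1 : k) ∈ I ↔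
    F \ negSupport a ∉ degreeComplex I a)
  mem_right : ∀ F, negSupport a ⊆ F → (MvPolynomial.monomial (shiftExp a s F) (1 : k) ∈ J ↔
    F \ negSupport a ∉ degreeComplex J a)

theorem exists_isLarge (I J : Ideal (MvPolynomial (Fin n) k)) :
    ∃ T : ℕ, ∀ s, T ≤ s → IsLarge a I J s := by
  obtain ⟨T, hT⟩ := exists_shiftExp_mem_iff a I
  obtain ⟨T', hT'⟩ := exists_shiftExp_mem_iff a J
  refine ⟨max (max T T') (∑ j, (a j).natAbs + 1), fun s hs => ?_⟩
  simp only [max_le_iff] at hs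
  refine ⟨by omega, fun j => ?_, hT s hs.1.1, hT' s hs.1.2⟩
  have haj := Finset.single_le_sum (f := fun j => (a j).natAbs) (fun _ _ => Nat.zero_le _)
    (Finset.mem_univ j)
  omega

end DegreeComplex

/-! ### The strand of degree `a` of the Koszul cochains -/

section Strand

variable {k : Type u} [Field k] {n : ℕ} {I J : Ideal (MvPolynomial (Fin n) k)}

/-- The value of a linear map on the basis element indexed by `F`, and zero if there is none. -/
def basisVal {i : ℕ} {N : Type*} [AddCommGroup N] [Module (MvPolynomial (Fin n) k) N]
    (f : TaylorX k n (Fin n) i →ₗ[MvPolynomial (Fin n) k] N) (F : Finset (Fin n)) : N :=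
  if h : F.card = i then f (Finsupp.single ⟨F, h⟩ 1) else 0

theorem basisVal_of_card {i : ℕ} {N : Type*} [AddCommGroup N] [Module (MvPolynomial (Fin n) k) N]
    (f : TaylorX k n (Fin n) i →ₗ[MvPolynomial (Fin n) k] N) {F : Finset (Fin n)}
    (h : F.card = i) : basisVal f F = f (Finsupp.single ⟨F, h⟩ 1) :=
  dif_pos h

theorem basisVal_comp_taylorDiff (β : Fin n → Fin n →₀ ℕ) {i : ℕ} {N : Type*} [AddCommGroup N]
    [Module (MvPolynomial (Fin n) k) N]
    (g : TaylorX k n (Fin n) i →ₗ[MvPolynomial (Fin n) k] N) {F : Finset (Fin n)}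
    (h : F.card = i + 1) :
    basisVal (g ∘ₗ taylorDiff β (i + 1) i) F =
      ∑ v ∈ F, MvPolynomial.monomial (F.sup β - (F.erase v).sup β) ((-1 : k) ^ pos F v) •
        basisVal g (F.erase v) := by
  have h1 : (1 : MvPolynomial (Fin n) k) = MvPolynomial.monomial 0 1 := rfl
  have hc : ∀ v : {v // v ∈ F}, (F.erase v.1).card = i := fun v => by
    rw [Finset.card_erase_of_mem v.2, h, Nat.add_sub_cancel]
  rw [basisVal_of_card _ h, LinearMap.comp_apply, h1, taylorDiff_single, map_sum,
    ← Finset.sum_coe_sort F]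
  refine Finset.sum_congr rfl fun v _ => ?_
  rw [basisVal_of_card g (hc v), ← map_smul, Finsupp.smul_single, smul_eq_mul, mul_one, mul_one,
    zero_add]

/-- The sign that compares the orientation of a face `F` disjoint from `G_a` with the one of
`F ∪ G_a`. -/
def faceSign (k : Type u) [Field k] (a : Fin n → ℤ) (F : Finset (Fin n)) : k :=
  ∏ u ∈ F, (-1 : k) ^ pos (negSupport a) u

theorem faceSign_mul_self (a : Fin n → ℤ) (F : Finset (Fin n)) :
    faceSign k a F * faceSign k a F = 1 := by
  rw [faceSign, ← Finset.prod_mul_distrib]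
  refine Finset.prod_eq_one fun u _ => ?_
  rw [← mul_pow, neg_mul_neg, one_mul, one_pow]

theorem faceSign_ne_zero (a : Fin n → ℤ) (F : Finset (Fin n)) : faceSign k a F ≠ 0 := fun h => by
  have := faceSign_mul_self (k := k) a F
  rw [h, zero_mul] at this
  exact zero_ne_one this

theorem pos_union {F G : Finset (Fin n)} (h : Disjoint F G) (v : Fin n) :
    pos (F ∪ G) v = pos F v + pos G v := by
  rw [pos, Finset.filter_union, Finset.card_union_of_disjoint (Finset.disjoint_filter_filter h)]
  rfl

/-- The sign intertwines the incidence numbers of `F` with those of `F ∪ G_a`. -/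
theorem faceSign_erase (a : Fin n → ℤ) {F : Finset (Fin n)} (hF : Disjoint F (negSupport a))
    {v : Fin n} (hv : v ∈ F) :
    faceSign k a F * (-1 : k) ^ pos (F ∪ negSupport a) v =
      (-1 : k) ^ pos F v * faceSign k a (F.erase v) := by
  have h1 : (-1 : k) ^ pos (negSupport a) v * (-1 : k) ^ pos (negSupport a) v = 1 := by
    rw [← mul_pow, neg_mul_neg, one_mul, one_pow]
  rw [faceSign, faceSign, ← Finset.mul_prod_erase F _ hv, pos_union hF, pow_add]
  linear_combination
    (∏ u ∈ F.erase v, (-1 : k) ^ pos (negSupport a) u) * (-1 : k) ^ pos F v * h1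

variable {a : Fin n → ℤ}

theorem disjoint_of_mem_degreeComplex {K : Ideal (MvPolynomial (Fin n) k)} {F : Finset (Fin n)}
    (h : F ∈ degreeComplex K a) : Disjoint F (negSupport a) :=
  Finset.disjoint_iff_inter_eq_empty.2 h.1

theorem notMem_of_mem_degreeComplex_right {s : ℕ} (hs : IsLarge a I J s) {F : Finset (Fin n)}
    (h : F ∈ degreeComplex J a) :
    MvPolynomial.monomial (shiftExp a s (F ∪ negSupport a)) (1 : k) ∉ J := by
  rw [hs.mem_right _ Finset.subset_union_right, not_not, Finset.union_sdiff_cancel_right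
    (disjoint_of_mem_degreeComplex h)]
  exact h

theorem notMem_of_mem_degreeComplex_left {s : ℕ} (hs : IsLarge a I J s) {F : Finset (Fin n)}
    (h : F ∈ degreeComplex I a) :
    MvPolynomial.monomial (shiftExp a s (F ∪ negSupport a)) (1 : k) ∉ I := by
  rw [hs.mem_left _ Finset.subset_union_right, not_not, Finset.union_sdiff_cancel_right
    (disjoint_of_mem_degreeComplex h)]
  exact h

variable (hI : IsMonomialIdeal I) (hJ : IsMonomialIdeal J) (hle : J ≤ I)

/-- The relative cochain on `(Δ_a(J), Δ_a(I))` attached to a linear map from a term of the Koszul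
complex on `x_1^s, …, x_n^s` to `I/J`: its value on `F` is, up to a sign, the coefficient of
`x^(a + s ∑_{j ∈ F ∪ G_a} e_j)` in the value of the map at the basis element of `F ∪ G_a`. -/
def strand {s : ℕ} (hs : IsLarge a I J s) {i : ℕ}
    (f : TaylorX k n (Fin n) i →ₗ[MvPolynomial (Fin n) k] IdealQuot I J) (t : ℤ) :
    RelChain (relDegreeComplex hle a) t →ₗ[ℤ] k :=
  cochainOf t (fun F => faceSign k a F * quotCoeff I hJ (shiftExp a s (F ∪ negSupport a))
    (basisVal f (F ∪ negSupport a))) fun F hF => by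
      rw [quotCoeff_of_notMem hJ hI (notMem_of_mem_degreeComplex_left hs hF), mul_zero]

theorem cochainVal_strand {s : ℕ} (hs : IsLarge a I J s) {i : ℕ}
    (f : TaylorX k n (Fin n) i →ₗ[MvPolynomial (Fin n) k] IdealQuot I J) (t : ℤ)
    (F : Face (relDegreeComplex hle a).Δ t) :
    cochainVal (strand hI hJ hle hs f t) F =
      faceSign k a F.1 * quotCoeff I hJ (shiftExp a s (F.1 ∪ negSupport a))
        (basisVal f (F.1 ∪ negSupport a)) :=
  cochainVal_cochainOf _ _ F

theorem card_union_negSupport {i : ℕ} {t : ℤ} (ht : t + 1 + (negSupport a).card = i)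
    (F : Face (relDegreeComplex hle a).Δ t) : (F.1 ∪ negSupport a).card = i := by
  rw [Finset.card_union_of_disjoint (disjoint_of_mem_degreeComplex F.2.1)]
  have := F.2.2
  omega

theorem strand_add {s : ℕ} (hs : IsLarge a I J s) {i : ℕ} {t : ℤ}
    (ht : t + 1 + (negSupport a).card = i)
    (f g : TaylorX k n (Fin n) i →ₗ[MvPolynomial (Fin n) k] IdealQuot I J) :
    strand hI hJ hle hs (f + g) t = strand hI hJ hle hs f t + strand hI hJ hle hs g t := by
  refine cochain_ext fun F => ?_
  have hc := card_union_negSupport hle ht F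
  refine Eq.trans ?_ (congrArg₂ (· + ·) (cochainVal_strand hI hJ hle hs f t F)
    (cochainVal_strand hI hJ hle hs g t F)).symm
  simp only [cochainVal_strand, basisVal_of_card _ hc, LinearMap.add_apply, map_add, mul_add]

theorem strand_C_smul {s : ℕ} (hs : IsLarge a I J s) {i : ℕ} {t : ℤ}
    (ht : t + 1 + (negSupport a).card = i) (r : k)
    (f : TaylorX k n (Fin n) i →ₗ[MvPolynomial (Fin n) k] IdealQuot I J) :
    strand hI hJ hle hs ((MvPolynomial.C r : MvPolynomial (Fin n) k) • f) t =
      r • strand hI hJ hle hs f t := by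
  refine cochain_ext fun F => ?_
  have hc := card_union_negSupport hle ht F
  refine Eq.trans ?_ (congrArg (r * ·) (cochainVal_strand hI hJ hle hs f t F)).symm
  rw [cochainVal_strand, basisVal_of_card _ hc, basisVal_of_card _ hc, LinearMap.smul_apply,
    ← MvPolynomial.monomial_zero', quotCoeff_monomial_smul hJ
      (notMem_of_mem_degreeComplex_right hs F.2.1), if_pos zero_le, tsub_zero]
  ring

/-- The strand is a map of complexes, from `Hom(Koszul, I/J)` to the relative cochains. -/
theorem strand_comp_taylorDiff {s : ℕ} (hs : IsLarge a I J s) {i : ℕ} {t t' : ℤ}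
    (htt' : t' = t + 1) (ht : t + 1 + (negSupport a).card = i)
    (g : TaylorX k n (Fin n) i →ₗ[MvPolynomial (Fin n) k] IdealQuot I J) :
    strand hI hJ hle hs (g ∘ₗ taylorDiff (powExp n s) (i + 1) i) t' =
      coboundary k (relDegreeComplex hle a) htt' (strand hI hJ hle hs g t) := by
  refine cochain_ext fun F => ?_
  have hc := card_union_negSupport hle (i := i + 1) (by push_cast; omega) F
  have hdisj := disjoint_of_mem_degreeComplex F.2.1
  have hm := notMem_of_mem_degreeComplex_right hs F.2.1
  rw [cochainVal_strand, cochainVal_coboundary, basisVal_comp_taylorDiff _ _ hc, map_sum,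
    Finset.sum_union hdisj, Finset.sum_eq_zero (s := negSupport a), add_zero, Finset.mul_sum,
    ← Finset.sum_coe_sort F.1]
  · refine Finset.sum_congr rfl fun v _ => ?_
    have hvG : v.1 ∉ negSupport a := Finset.disjoint_left.1 hdisj v.2
    have hv : v.1 ∈ F.1 ∪ negSupport a := Finset.mem_union_left _ v.2
    obtain ⟨h1, h2⟩ := shiftExp_erase a (s := s) hv hvG
    have h3 : (F.1 ∪ negSupport a).erase v = F.1.erase v ∪ negSupport a := by
      rw [Finset.erase_union_distrib, Finset.erase_eq_of_notMem hvG]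
    rw [quotCoeff_monomial_smul hJ hm, sup_powExp_sub_erase s hv, if_pos h1, h2, h3, ← mul_assoc,
      faceSign_erase a hdisj v.2, cochainVal_strand, mul_assoc]
    rfl
  · -- The facets that drop some `v ∈ G_a` do not contribute: `x_v^s` does not divide the monomial.
    intro v hvG
    have hv : v ∈ F.1 ∪ negSupport a := Finset.mem_union_right _ hvG
    rw [quotCoeff_monomial_smul hJ hm, sup_powExp_sub_erase s hv,
      if_neg (not_single_le_shiftExp a hs.pos hv hvG)]

/-- The strand does not change under the comparison maps of Koszul complexes. -/
theorem strand_comp_taylorMap {s s' : ℕ} (hs : IsLarge a I J s) (hs' : IsLarge a I J s')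
    (hss' : s ≤ s') {i : ℕ} {t : ℤ} (ht : t + 1 + (negSupport a).card = i)
    (f : TaylorX k n (Fin n) i →ₗ[MvPolynomial (Fin n) k] IdealQuot I J) :
    strand hI hJ hle hs' (f ∘ₗ taylorMap (powExp n s') (powExp n s) i) t =
      strand hI hJ hle hs f t := by
  refine cochain_ext fun F => ?_
  have hc := card_union_negSupport hle ht F
  have h1 := shiftExp_eq_add a hs.nonneg hss' (F := F.1 ∪ negSupport a) Finset.subset_union_right
  have h2 : ∀ m : Fin n →₀ ℕ, Finsupp.single (⟨F.1 ∪ negSupport a, hc⟩ :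
      {F : Finset (Fin n) // F.card = i}) (MvPolynomial.monomial m (1 : k)) =
      MvPolynomial.monomial m (1 : k) • Finsupp.single _ 1 := fun m => by
    rw [Finsupp.smul_single, smul_eq_mul, mul_one]
  rw [cochainVal_strand, cochainVal_strand, basisVal_of_card _ hc, basisVal_of_card _ hc,
    LinearMap.comp_apply, taylorMap_single, one_mul, h2, map_smul,
    quotCoeff_monomial_smul hJ (notMem_of_mem_degreeComplex_right hs' F.2.1), h1,
    if_pos le_add_self, add_tsub_cancel_right, one_mul]

/-- The linear map `f` from a term of the Koszul complex on `x_1^s, …, x_n^s` to `I/J` is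
homogeneous of degree `a`. It suffices to require this on the basis. -/
def IsHomogeneousMap (a : Fin n → ℤ) (s : ℕ) {i : ℕ}
    (f : TaylorX k n (Fin n) i →ₗ[MvPolynomial (Fin n) k] IdealQuot I J) : Prop :=
  ∀ F, f (Finsupp.single F 1) ∈ idealQuotPart I J (expZ (F.1.sup (powExp n s)) + a)

theorem IsHomogeneousMap.add {s i : ℕ}
    {f g : TaylorX k n (Fin n) i →ₗ[MvPolynomial (Fin n) k] IdealQuot I J}
    (hf : IsHomogeneousMap a s f) (hg : IsHomogeneousMap a s g) :
    IsHomogeneousMap a s (f + g) := fun F => add_mem (hf F) (hg F)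

theorem IsHomogeneousMap.C_smul {s i : ℕ}
    {f : TaylorX k n (Fin n) i →ₗ[MvPolynomial (Fin n) k] IdealQuot I J}
    (hf : IsHomogeneousMap a s f) (r : k) :
    IsHomogeneousMap a s ((MvPolynomial.C r : MvPolynomial (Fin n) k) • f) := fun F => by
  have h := idealQuotPart_gradedSMul.smul_mem (monomial_mem_polyPart 0 r expZ_zero) (hf F)
  rwa [vadd_eq_add, zero_add] at h

theorem IsHomogeneousMap.comp_taylorDiff {s i : ℕ}
    {f : TaylorX k n (Fin n) i →ₗ[MvPolynomial (Fin n) k] IdealQuot I J}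
    (hf : IsHomogeneousMap a s f) (j : ℕ) :
    IsHomogeneousMap a s (f ∘ₗ taylorDiff (powExp n s) j i) := fun F =>
  map_mem_of_basis (powExp n s) idealQuotPart_gradedSMul f a hf
    (taylorDiff_mem _ j i (basis_mem_taylorPart _ F))

theorem IsHomogeneousMap.comp_taylorMap {s s' i : ℕ} (hss' : s ≤ s')
    {f : TaylorX k n (Fin n) i →ₗ[MvPolynomial (Fin n) k] IdealQuot I J}
    (hf : IsHomogeneousMap a s f) :
    IsHomogeneousMap a s' (f ∘ₗ taylorMap (powExp n s') (powExp n s) i) := fun F => by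
  refine map_mem_of_basis (powExp n s) idealQuotPart_gradedSMul f a hf ?_
  rw [taylorMap_single, one_mul]
  exact single_mem_taylorPart _ F (monomial_mem_polyPart _ _
    (expZ_sub (sup_le_sup_of_le (powExp_mono hss') F.1)))

/-- A homogeneous map of degree `a` is determined by its strand. -/
theorem IsHomogeneousMap.eq_zero {s : ℕ} (hs : IsLarge a I J s) {i : ℕ} {t : ℤ}
    (ht : t + 1 + (negSupport a).card = i)
    {f : TaylorX k n (Fin n) i →ₗ[MvPolynomial (Fin n) k] IdealQuot I J}
    (hf : IsHomogeneousMap a s f) (h0 : strand hI hJ hle hs f t = 0) : f = 0 := by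
  refine Finsupp.lhom_ext' fun F => LinearMap.ext_ring ?_
  refine eq_zero_of_quotCoeff hJ (hf F) fun m hm hmJ => ?_
  -- A basis element whose `F` does not contain `G_a` maps to a degree with a negative entry.
  have hGF : negSupport a ⊆ F.1 := by
    intro v hv
    by_contra hvF
    have h1 := congrFun hm v
    have h2 := mem_negSupport.1 hv
    rw [Pi.add_apply, expZ, expZ, sup_powExp_apply, if_neg hvF] at h1
    push_cast at h1
    omega
  obtain rfl : m = shiftExp a s F.1 := expZ_injective (by rw [hm, expZ_shiftExp a hs.nonneg hGF])
  have hFΔ : F.1 \ negSupport a ∈ degreeComplex J a := by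
    by_contra h
    exact hmJ ((hs.mem_right F.1 hGF).2 h)
  have hcard := Finset.card_sdiff_add_card_eq_card hGF
  have hF2 := F.2
  have h1 := cochainVal_strand hI hJ hle hs f t ⟨F.1 \ negSupport a, hFΔ, by omega⟩
  simp only [Finset.sdiff_union_of_subset hGF, basisVal_of_card f F.2] at h1
  rw [h0] at h1
  exact (mul_eq_zero.1 h1.symm).resolve_left (faceSign_ne_zero a _)

theorem IsHomogeneousMap.ext {s : ℕ} (hs : IsLarge a I J s) {i : ℕ} {t : ℤ}
    (ht : t + 1 + (negSupport a).card = i)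
    {f g : TaylorX k n (Fin n) i →ₗ[MvPolynomial (Fin n) k] IdealQuot I J}
    (hf : IsHomogeneousMap a s f) (hg : IsHomogeneousMap a s g)
    (h : strand hI hJ hle hs f t = strand hI hJ hle hs g t) : f = g := by
  have h1 : IsHomogeneousMap a s (f + (MvPolynomial.C (-1) : MvPolynomial (Fin n) k) • g) :=
    hf.add (hg.C_smul (-1))
  have h2 := h1.eq_zero hI hJ hle hs ht (by
    rw [strand_add hI hJ hle hs ht, strand_C_smul hI hJ hle hs ht, h, neg_one_smul, add_neg_cancel])
  have h3 : (MvPolynomial.C (-1 : k) : MvPolynomial (Fin n) k) • g = -g := by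
    rw [map_neg, map_one]
    exact neg_one_smul _ g
  rw [h3] at h2
  exact add_neg_eq_zero.1 h2

/-- Every relative cochain is the strand of a homogeneous map of degree `a`. -/
theorem exists_strand_eq {s : ℕ} (hs : IsLarge a I J s) {i : ℕ} {t : ℤ}
    (ht : t + 1 + (negSupport a).card = i) (l : RelChain (relDegreeComplex hle a) t →ₗ[ℤ] k) :
    ∃ f : TaylorX k n (Fin n) i →ₗ[MvPolynomial (Fin n) k] IdealQuot I J,
      IsHomogeneousMap a s f ∧ strand hI hJ hle hs f t = l := by
  classical
  have hex : ∀ F : {F : Finset (Fin n) // F.card = i}, ∃ y : IdealQuot I J,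
      y ∈ idealQuotPart I J (expZ (F.1.sup (powExp n s)) + a) ∧
      ∀ F' : Face (relDegreeComplex hle a).Δ t, F'.1 ∪ negSupport a = F.1 →
        faceSign k a F'.1 * quotCoeff I hJ (shiftExp a s F.1) y = cochainVal l F' := by
    intro F
    by_cases h : ∃ F' : Face (relDegreeComplex hle a).Δ t, F'.1 ∪ negSupport a = F.1 ∧
      F'.1 ∉ degreeComplex I a
    · obtain ⟨F', hF', hF'I⟩ := h
      have hGF : negSupport a ⊆ F.1 := hF' ▸ Finset.subset_union_right
      have hsd : F.1 \ negSupport a = F'.1 := by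
        rw [← hF', Finset.union_sdiff_cancel_right (disjoint_of_mem_degreeComplex F'.2.1)]
      have hmI : MvPolynomial.monomial (shiftExp a s F.1) (1 : k) ∈ I :=
        (hs.mem_left F.1 hGF).2 (hsd ▸ hF'I)
      have hmJ : MvPolynomial.monomial (shiftExp a s F.1) (1 : k) ∉ J :=
        hF' ▸ notMem_of_mem_degreeComplex_right hs F'.2.1
      let p : I := (MvPolynomial.C (faceSign k a F'.1 * cochainVal l F') :
        MvPolynomial (Fin n) k) • ⟨_, hmI⟩
      have hp : p.1 = MvPolynomial.monomial (shiftExp a s F.1)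
          (faceSign k a F'.1 * cochainVal l F') := by
        change MvPolynomial.C _ * _ = _
        rw [MvPolynomial.C_mul_monomial, mul_one]
      refine ⟨(J.submoduleOf I).mkQ p, ⟨p, ?_, rfl⟩, fun F'' hF'' => ?_⟩
      · change p.1 ∈ polyPart k n _
        rw [hp]
        exact monomial_mem_polyPart _ _ (expZ_shiftExp a hs.nonneg hGF)
      · have hFF : F'' = F' := by
          refine Subtype.ext ?_
          rw [← hsd, ← hF'',
            Finset.union_sdiff_cancel_right (disjoint_of_mem_degreeComplex F''.2.1)]
        rw [hFF, quotCoeff_mk hJ hmJ, hp, MvPolynomial.coeff_monomial, if_pos rfl, ← mul_assoc,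
          faceSign_mul_self, one_mul]
    · refine ⟨0, zero_mem _, fun F' hF' => ?_⟩
      have hF'I : F'.1 ∈ degreeComplex I a := by
        by_contra h'
        exact h ⟨F', hF', h'⟩
      rw [map_zero, mul_zero, cochainVal_of_mem l hF'I]
  choose y hy hyl using hex
  have hval : ∀ F, (Finsupp.lsum (MvPolynomial (Fin n) k) fun F => LinearMap.toSpanSingleton
      (MvPolynomial (Fin n) k) (IdealQuot I J) (y F)) (Finsupp.single F 1) = y F := fun F => by
    rw [Finsupp.lsum_single, LinearMap.toSpanSingleton_apply, one_smul]
  refine ⟨Finsupp.lsum (MvPolynomial (Fin n) k) fun F => LinearMap.toSpanSingleton _ _ (y F),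
    fun F => ?_, cochain_ext fun F' => ?_⟩
  · rw [hval]; exact hy F
  · have hc := card_union_negSupport hle ht F'
    rw [cochainVal_strand, basisVal_of_card _ hc, hval]
    exact hyl ⟨_, hc⟩ F' rfl

end Strand

/-! ### The isomorphism -/

section Iso

variable {k : Type u} [Field k] {n : ℕ} {I J : Ideal (MvPolynomial (Fin n) k)} {a : Fin n → ℤ}
  (hI : IsMonomialIdeal I) (hJ : IsMonomialIdeal J) (hle : J ≤ I) {T : ℕ}
  (hT : ∀ s, T ≤ s → IsLarge a I J s) {i : ℕ} {t : ℤ}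

theorem IsLocalClass.cocycle {S : Type u} [CommRing S] {𝔞 K : Ideal S} {M : ModuleCat.{u} S}
    {P : ProjectiveResolution (ModuleCat.of S (S ⧸ K))} {f : P.complex.X i ⟶ M}
    {h : (localCohomology 𝔞 i).obj M} (hf : IsLocalClass P f h) (j : ℕ) :
    P.complex.d j i ≫ f = 0 := by
  obtain ⟨_, _, e, he, -⟩ := hf
  exact isExtClass_cocycle he j

theorem IsLocalClass.koszul_map {s s' : ℕ} (hss' : s ≤ s')
    {M : ModuleCat.{u} (MvPolynomial (Fin n) k)}
    {f : TaylorX k n (Fin n) i →ₗ[MvPolynomial (Fin n) k] M}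
    {h : (localCohomology (MvPolynomial.idealOfVars (Fin n) k) i).obj M}
    (hf : IsLocalClass (koszul k n s) (ModuleCat.ofHom f) h) :
    IsLocalClass (koszul k n s')
      (ModuleCat.ofHom (f ∘ₗ taylorMap (powExp n s') (powExp n s) i)) h :=
  hf.map (monomialSpan_anti (powExp_mono hss')) (taylorResolutionMap_comm (powExp_mono hss'))
    (pow_le_monomialSpan_powExp s')

/-- `h ∈ H^i_𝔪(I/J)` is the class of the homogeneous cocycle of degree `a` on the Koszul complex on
`x_1^T, …, x_n^T` whose strand is `l`. -/
def IsClassOf (l : RelChain (relDegreeComplex hle a) t →ₗ[ℤ] k)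
    (h : (localCohomology (MvPolynomial.idealOfVars (Fin n) k) i).obj
      (ModuleCat.of (MvPolynomial (Fin n) k) (IdealQuot I J))) : Prop :=
  ∃ f : TaylorX k n (Fin n) i →ₗ[MvPolynomial (Fin n) k] IdealQuot I J,
    IsHomogeneousMap a T f ∧ strand hI hJ hle (hT T le_rfl) f t = l ∧
    IsLocalClass (koszul k n T)
      (ModuleCat.ofHom f : _ ⟶ ModuleCat.of (MvPolynomial (Fin n) k) (IdealQuot I J)) h

variable {hI hJ hle hT} {l l' : RelChain (relDegreeComplex hle a) t →ₗ[ℤ] k}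
  {h h' : (localCohomology (MvPolynomial.idealOfVars (Fin n) k) i).obj
    (ModuleCat.of (MvPolynomial (Fin n) k) (IdealQuot I J))}

theorem IsClassOf.unique (ht : t + 1 + (negSupport a).card = i)
    (hl : IsClassOf hI hJ hle hT l h) (hl' : IsClassOf hI hJ hle hT l h') : h = h' := by
  obtain ⟨f, hf, rfl, hfh⟩ := hl
  obtain ⟨f', hf', hff', hfh'⟩ := hl'
  obtain rfl := hf'.ext hI hJ hle _ ht hf hff'
  exact hfh.unique hfh'

theorem IsClassOf.add (ht : t + 1 + (negSupport a).card = i)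
    (hl : IsClassOf hI hJ hle hT l h) (hl' : IsClassOf hI hJ hle hT l' h') :
    IsClassOf hI hJ hle hT (l + l') (h + h') := by
  obtain ⟨f, hf, rfl, hfh⟩ := hl
  obtain ⟨f', hf', rfl, hfh'⟩ := hl'
  exact ⟨f + f', hf.add hf', strand_add hI hJ hle _ ht f f', hfh.add hfh'⟩

theorem IsClassOf.C_smul (ht : t + 1 + (negSupport a).card = i)
    (hl : IsClassOf hI hJ hle hT l h) (r : k) :
    IsClassOf hI hJ hle hT (r • l) ((MvPolynomial.C r : MvPolynomial (Fin n) k) • h) := by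
  obtain ⟨f, hf, rfl, hfh⟩ := hl
  exact ⟨_, hf.C_smul r, strand_C_smul hI hJ hle _ ht r f, hfh.smul _⟩

theorem IsClassOf.isHomogeneousClass (hl : IsClassOf hI hJ hle hT l h) :
    IsHomogeneousClass (ModuleCat.of (MvPolynomial (Fin n) k) (IdealQuot I J))
      (idealQuotPart I J) i a h := by
  obtain ⟨f, hf, -, hfh⟩ := hl
  exact isHomogeneousClass_of_koszul (M := ModuleCat.of (MvPolynomial (Fin n) k) (IdealQuot I J))
    (𝓜 := idealQuotPart I J) idealQuotPart_gradedSMul (s := T) (a := a) f hf hfh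

variable (hI hJ hle hT)

theorem strand_zero {s : ℕ} (hs : IsLarge a I J s) (ht : t + 1 + (negSupport a).card = i) :
    strand hI hJ hle hs (0 : TaylorX k n (Fin n) i →ₗ[MvPolynomial (Fin n) k] IdealQuot I J) t =
      0 := by
  have h := strand_add hI hJ hle hs ht 0 0
  rw [add_zero] at h
  exact left_eq_add.1 h

theorem comp_taylorDiff_eq_zero (ht : t + 1 + (negSupport a).card = i)
    (hl : coboundary k (relDegreeComplex hle a) (s := t + 1) rfl l = 0)
    {f : TaylorX k n (Fin n) i →ₗ[MvPolynomial (Fin n) k] IdealQuot I J}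
    (hf : IsHomogeneousMap a T f) (hfl : strand hI hJ hle (hT T le_rfl) f t = l) :
    f ∘ₗ taylorDiff (powExp n T) (i + 1) i = 0 := by
  refine (hf.comp_taylorDiff (i + 1)).eq_zero hI hJ hle (hT T le_rfl) (t := t + 1)
    (by push_cast; omega) ?_
  rw [strand_comp_taylorDiff hI hJ hle _ rfl ht, hfl, hl]

theorem exists_isClassOf (ht : t + 1 + (negSupport a).card = i)
    (hl : coboundary k (relDegreeComplex hle a) (s := t + 1) rfl l = 0) :
    ∃ h : (localCohomology (MvPolynomial.idealOfVars (Fin n) k) i).obj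
      (ModuleCat.of (MvPolynomial (Fin n) k) (IdealQuot I J)), IsClassOf hI hJ hle hT l h := by
  obtain ⟨f, hf, hfl⟩ := exists_strand_eq hI hJ hle (hT T le_rfl) ht l
  obtain ⟨h, hh⟩ := exists_isLocalClass (koszul k n T)
    (ModuleCat.ofHom f : _ ⟶ ModuleCat.of (MvPolynomial (Fin n) k) (IdealQuot I J))
    (ModuleCat.hom_ext (comp_taylorDiff_eq_zero hI hJ hle hT ht hl hf hfl))
    (pow_le_monomialSpan_powExp T)
  exact ⟨h, f, hf, hfl, hh⟩

/-- Every homogeneous class of degree `a` already comes from the exponent `T`: a cocycle that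
represents it for a larger exponent has the same strand as a cocycle for `T`. -/
theorem exists_isClassOf_of_isHomogeneousClass (ht : t + 1 + (negSupport a).card = i)
    (hh : IsHomogeneousClass (ModuleCat.of (MvPolynomial (Fin n) k) (IdealQuot I J))
      (idealQuotPart I J) i a h) :
    ∃ l : RelChain (relDegreeComplex hle a) t →ₗ[ℤ] k,
      coboundary k (relDegreeComplex hle a) (s := t + 1) rfl l = 0 ∧
      IsClassOf hI hJ hle hT l h := by
  obtain ⟨t₀, ht₀⟩ := hh.exists_koszul
  obtain ⟨s, hTs, hts⟩ : ∃ s, T ≤ s ∧ t₀ ≤ s := ⟨max T t₀, le_max_left _ _, le_max_right _ _⟩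
  obtain ⟨f, hf, hfh⟩ : ∃ f : TaylorX k n (Fin n) i →ₗ[MvPolynomial (Fin n) k] IdealQuot I J,
      IsHomogeneousMap a s f ∧ IsLocalClass (koszul k n s) (ModuleCat.ofHom f : _ ⟶
        ModuleCat.of (MvPolynomial (Fin n) k) (IdealQuot I J)) h := ht₀ s hts
  have hl : coboundary k (relDegreeComplex hle a) (s := t + 1) rfl
      (strand hI hJ hle (hT s hTs) f t) = 0 := by
    have h1 : f ∘ₗ taylorDiff (powExp n s) (i + 1) i = 0 :=
      congrArg ModuleCat.Hom.hom (hfh.cocycle (i + 1))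
    rw [← strand_comp_taylorDiff hI hJ hle (hT s hTs) rfl ht, h1,
      strand_zero hI hJ hle (hT s hTs) (by push_cast; omega)]
  obtain ⟨h', g, hg, hgl, hgh⟩ := exists_isClassOf hI hJ hle hT ht hl
  have hgf : g ∘ₗ taylorMap (powExp n s) (powExp n T) i = f := by
    refine (hg.comp_taylorMap hTs).ext hI hJ hle (hT s hTs) ht hf ?_
    rw [strand_comp_taylorMap hI hJ hle (hT T le_rfl) (hT s hTs) hTs ht, hgl]
  have hgh' := IsLocalClass.koszul_map (M := ModuleCat.of (MvPolynomial (Fin n) k) (IdealQuot I J))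
    (f := g) hTs hgh
  have hgf' : ModuleCat.ofHom (g ∘ₗ taylorMap (powExp n s) (powExp n T) i) =
    ModuleCat.ofHom f := congrArg ModuleCat.ofHom hgf
  obtain rfl : h' = h := IsLocalClass.unique (P := koszul k n s) (hgf' ▸ hgh') hfh
  exact ⟨_, hl, g, hg, hgl, hgh⟩

/-- The class of a cocycle vanishes iff its strand is a coboundary: a coboundary that appears only
for a larger exponent has a strand on the same pair of complexes. -/
theorem isClassOf_zero_iff (ht : t + 1 + (negSupport a).card = i)
    (hl : IsClassOf hI hJ hle hT l h) :
    h = 0 ↔ l ∈ LinearMap.range (coboundary k (relDegreeComplex hle a) (s := t) (t := t - 1)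
      (by omega)) := by
  obtain ⟨f, hf, rfl, hfh⟩ := hl
  constructor
  · rintro rfl
    obtain ⟨t₀, ht₀⟩ := hfh.exists_boundary
    obtain ⟨s, hTs, hts⟩ : ∃ s, T ≤ s ∧ t₀ ≤ s := ⟨max T t₀, le_max_left _ _, le_max_right _ _⟩
    obtain ⟨j, g, hg⟩ : ∃ (j : ℕ)
        (g : TaylorX k n (Fin n) j →ₗ[MvPolynomial (Fin n) k] IdealQuot I J),
        f ∘ₗ taylorMap (powExp n s) (powExp n T) i = g ∘ₗ taylorDiff (powExp n s) i j := by
      obtain ⟨j, g, hg⟩ := ht₀ (monomialSpan k (powExp n s)) (monomialSpan_powExp_le hts)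
        (monomialSpan_anti (powExp_mono hTs)) (koszul k n s)
        (taylorResolutionMap (powExp_mono hTs)) (taylorResolutionMap_comm _)
      exact ⟨j, g.hom, congrArg ModuleCat.Hom.hom hg⟩
    rw [← strand_comp_taylorMap hI hJ hle (hT T le_rfl) (hT s hTs) hTs ht, hg]
    by_cases hij : j + 1 = i
    · subst hij
      refine ⟨strand hI hJ hle (hT s hTs) g (t - 1), ?_⟩
      exact (strand_comp_taylorDiff hI hJ hle (hT s hTs) (by omega)
        (by push_cast at ht; omega) g).symm
    · rw [taylorDiff_of_ne _ hij, LinearMap.comp_zero, strand_zero hI hJ hle (hT s hTs) ht]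
      exact Submodule.zero_mem _
  · rintro ⟨m, hm⟩
    have hfd : ∃ (j : ℕ) (g : TaylorX k n (Fin n) j →ₗ[MvPolynomial (Fin n) k] IdealQuot I J),
        f = g ∘ₗ taylorDiff (powExp n T) i j := by
      cases i with
      | zero =>
        -- Here `t - 1 < -1`, so that there are no faces of this dimension.
        have hm0 : m = 0 := cochain_ext fun F => by
          have := F.2.2
          push_cast at ht
          omega
        refine ⟨0, 0, ?_⟩
        rw [LinearMap.zero_comp]
        refine hf.eq_zero hI hJ hle (hT T le_rfl) ht ?_
        rw [← hm, hm0, map_zero]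
      | succ j =>
        have ht' : t - 1 + 1 + (negSupport a).card = j := by push_cast at ht; omega
        obtain ⟨g, hg, rfl⟩ := exists_strand_eq hI hJ hle (hT T le_rfl) ht' m
        refine ⟨j, g, hf.ext hI hJ hle (hT T le_rfl) ht (hg.comp_taylorDiff _) ?_⟩
        rw [strand_comp_taylorDiff hI hJ hle _ (by omega) ht', hm]
    obtain ⟨j, g, rfl⟩ := hfd
    exact IsLocalClass.of_boundary (P := koszul k n T)
      (M := ModuleCat.of (MvPolynomial (Fin n) k) (IdealQuot I J)) (ModuleCat.ofHom g) hfh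

/-- The class of a cocycle of the pair of degree complexes in the local cohomology of `I/J`. -/
def cocycleClass (ht : t + 1 + (negSupport a).card = i) :
    LinearMap.ker (coboundary k (relDegreeComplex hle a) (s := t + 1) (t := t) rfl) →ₗ[k]
      (ModuleCat.restrictScalars (MvPolynomial.C : k →+* MvPolynomial (Fin n) k)).obj
        ((localCohomology (MvPolynomial.idealOfVars (Fin n) k) i).obj
          (ModuleCat.of (MvPolynomial (Fin n) k) (IdealQuot I J))) where
  toFun l := (exists_isClassOf hI hJ hle hT ht l.2).choose
  map_add' l l' := (exists_isClassOf hI hJ hle hT ht (l + l').2).choose_spec.unique ht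
    ((exists_isClassOf hI hJ hle hT ht l.2).choose_spec.add ht
      (exists_isClassOf hI hJ hle hT ht l'.2).choose_spec)
  map_smul' r l := (exists_isClassOf hI hJ hle hT ht (r • l).2).choose_spec.unique ht
    ((exists_isClassOf hI hJ hle hT ht l.2).choose_spec.C_smul ht r)

theorem isClassOf_cocycleClass (ht : t + 1 + (negSupport a).card = i)
    (l : LinearMap.ker (coboundary k (relDegreeComplex hle a) (s := t + 1) (t := t) rfl)) :
    IsClassOf hI hJ hle hT l.1 (cocycleClass hI hJ hle hT ht l) :=
  (exists_isClassOf hI hJ hle hT ht l.2).choose_spec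

theorem ker_cocycleClass (ht : t + 1 + (negSupport a).card = i) :
    LinearMap.ker (cocycleClass hI hJ hle hT ht) =
      (LinearMap.range (coboundary k (relDegreeComplex hle a) (s := t) (t := t - 1)
        (by omega))).submoduleOf
        (LinearMap.ker (coboundary k (relDegreeComplex hle a) (s := t + 1) (t := t) rfl)) := by
  ext l
  exact isClassOf_zero_iff hI hJ hle hT ht (isClassOf_cocycleClass hI hJ hle hT ht l)

/-- The homogeneous classes of degree `a` already form a subspace, the image of the cocycles. -/
theorem range_cocycleClass (ht : t + 1 + (negSupport a).card = i) :
    LinearMap.range (cocycleClass hI hJ hle hT ht) =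
      localCohomologyPart (ModuleCat.of (MvPolynomial (Fin n) k) (IdealQuot I J))
        (idealQuotPart I J) i a := by
  refine le_antisymm ?_ (Submodule.span_le.2 fun h hh => ?_)
  · rintro _ ⟨l, rfl⟩
    exact Submodule.subset_span (isClassOf_cocycleClass hI hJ hle hT ht l).isHomogeneousClass
  · obtain ⟨l, hl, hlh⟩ := exists_isClassOf_of_isHomogeneousClass hI hJ hle hT ht hh
    exact ⟨⟨l, hl⟩, (isClassOf_cocycleClass hI hJ hle hT ht ⟨l, hl⟩).unique ht hlh⟩

theorem nonempty_localCohomologyPart_equiv (hI : IsMonomialIdeal I) (hJ : IsMonomialIdeal J)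
    (hle : J ≤ I) (i : ℕ) (a : Fin n → ℤ) :
    Nonempty (localCohomologyPart (ModuleCat.of (MvPolynomial (Fin n) k) (IdealQuot I J))
        (idealQuotPart I J) i a ≃ₗ[k]
      RelCohomology k (relDegreeComplex hle a) ((i : ℤ) - (negSupport a).card - 1)) := by
  obtain ⟨T, hT⟩ := exists_isLarge a I J
  have ht : ((i : ℤ) - (negSupport a).card - 1) + 1 + (negSupport a).card = i := by ring
  exact ⟨(LinearEquiv.ofEq _ _ (range_cocycleClass hI hJ hle hT ht)).symm ≪≫ₗ
    (cocycleClass hI hJ hle hT ht).quotKerEquivRange.symm ≪≫ₗ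
    Submodule.quotEquivOfEq _ _ (ker_cocycleClass hI hJ hle hT ht)⟩

end Iso

/-! ### Degree complexes without faces -/

section Vanishing

variable {k : Type u} [Field k] {n : ℕ} {I J : Ideal (MvPolynomial (Fin n) k)} {a : Fin n → ℤ}

/-- The degree complex has no face if `∏_{j ∈ G_a} x_j` belongs to the radical: then some minimal
generator involves only the variables in `G_a`. -/
theorem notMem_degreeComplex
    (h : negSupport a ∉ stanleyReisner J.radical) (F : Finset (Fin n)) :
    F ∉ degreeComplex J a := by
  intro hF
  have h1 : ∏ j ∈ negSupport a, (MvPolynomial.X j : MvPolynomial (Fin n) k) ∈ J.radical := by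
    by_contra h'
    exact h h'
  obtain ⟨N, hN⟩ := h1
  have h2 : (∏ j ∈ negSupport a, (MvPolynomial.X j : MvPolynomial (Fin n) k)) ^ N =
      MvPolynomial.monomial (∑ j ∈ negSupport a, Finsupp.single j N) 1 := by
    rw [← Finset.prod_pow, MvPolynomial.monomial_sum_one]
    exact Finset.prod_congr rfl fun j _ => MvPolynomial.X_pow_eq_monomial
  rw [h2] at hN
  obtain ⟨b, hb, hbmin⟩ := exists_minimal_le_of_wellFoundedLT
    (fun c : Fin n →₀ ℕ => MvPolynomial.monomial c (1 : k) ∈ J) _ hN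
  obtain ⟨j, hj, hab⟩ := hF.2 b hbmin
  have hjG : j ∉ negSupport a := fun h => hj (Finset.mem_union_right _ h)
  have h3 := hb j
  have h4 : ∑ v ∈ negSupport a, Finsupp.single v N j = 0 := Finset.sum_eq_zero fun v hv =>
    Finsupp.single_eq_of_ne fun h => hjG (h.symm ▸ hv)
  rw [Finsupp.finsetSum_apply, h4] at h3
  rw [mem_negSupport] at hjG
  omega

end Vanishing

end RelativeTakayama

end

theorem theorem3p2 {k : Type u} [Field k] {n : ℕ} (I J : Ideal (MvPolynomial (Fin n) k))
    (hI : RelativeTakayama.IsMonomialIdeal I) (hJ : RelativeTakayama.IsMonomialIdeal J)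
    (hJI : J < I) (i : ℤ) (a : Fin n → ℤ) :
    Nonempty
      (RelativeTakayama.GradedLocalCohomology
          (ModuleCat.of (MvPolynomial (Fin n) k) (RelativeTakayama.IdealQuot I J))
          (RelativeTakayama.idealQuotPart I J) i a ≃ₗ[k]
        RelativeTakayama.RelCohomology k (RelativeTakayama.relDegreeComplex hJI.le a)
          (i - ((RelativeTakayama.negSupport a).card : ℤ) - 1)) ∧
    (RelativeTakayama.negSupport a ∉ RelativeTakayama.stanleyReisner J.radical →
      Subsingleton (RelativeTakayama.GradedLocalCohomology
        (ModuleCat.of (MvPolynomial (Fin n) k) (RelativeTakayama.IdealQuot I J))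
        (RelativeTakayama.idealQuotPart I J) i a)) := by
  have key : Nonempty
      (RelativeTakayama.GradedLocalCohomology
          (ModuleCat.of (MvPolynomial (Fin n) k) (RelativeTakayama.IdealQuot I J))
          (RelativeTakayama.idealQuotPart I J) i a ≃ₗ[k]
        RelativeTakayama.RelCohomology k (RelativeTakayama.relDegreeComplex hJI.le a)
          (i - ((RelativeTakayama.negSupport a).card : ℤ) - 1)) := by
    cases i with
    | ofNat i => exact RelativeTakayama.nonempty_localCohomologyPart_equiv hI hJ hJI.le i a
    | negSucc i =>
      have h1 : Subsingleton (RelativeTakayama.RelCohomology k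
          (RelativeTakayama.relDegreeComplex hJI.le a)
          (Int.negSucc i - ((RelativeTakayama.negSupport a).card : ℤ) - 1)) :=
        RelativeTakayama.subsingleton_relCohomology ⟨fun F => by
          have := F.2.2
          omega⟩
      have h2 : Subsingleton (RelativeTakayama.GradedLocalCohomology
          (ModuleCat.of (MvPolynomial (Fin n) k) (RelativeTakayama.IdealQuot I J))
          (RelativeTakayama.idealQuotPart I J) (Int.negSucc i) a) :=
        inferInstanceAs (Subsingleton PUnit)
      exact ⟨LinearEquiv.ofSubsingleton _ _⟩
  refine ⟨key, fun h => ?_⟩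
  have h1 := RelativeTakayama.subsingleton_relCohomology (k := k)
    (Φ := RelativeTakayama.relDegreeComplex hJI.le a)
    (t := i - ((RelativeTakayama.negSupport a).card : ℤ) - 1)
    ⟨fun F => RelativeTakayama.notMem_degreeComplex h F.1 F.2.1⟩
  exact key.some.toEquiv.subsingleton
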